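/- **Setting.** Let $\mathcal N\subseteq\mathbb R$ be an interval and let $p(x;\eta)=A(x)\exp(\eta x-F(\eta))$, $\eta\in\mathcal N$, be a one-parameter exponential family of probability densities with respect to a fixed dominating measure on $\mathbb R$, where $A\ge 0$ and $F$ is twice differentiable on $\mathcal N$. Put $\Theta=\dot F(\mathcal N)$. Consider $N\ge 2$ arms; the rewards of arm $i$ have density $p(\cdot;\eta_i)$ with mean $\theta_i=\dot F(\eta_i)$, and there is a unique optimal arm, say $\theta_1>\theta_i$ for all $i\neq 1$. Let $\Delta_a=\theta_1-\theta_a$ and $\Delta=\min_{a\ne1}\Delta_a$. Let $\underline\theta\in\mathbb R$ be a lower bound of the rewards: under every member of the family the reward is almost surely at least $\underline\theta$. For $n>0$ and $\alpha\in\mathbb R$ define the index $$I(\nu,n,\alpha)=(n\nu+\alpha)\,\dot F^{-1}\big([\nu+\tfrac{\alpha}{n}]_\Theta\big)-n\nu\,\dot F^{-1}(\nu)-nF\big(\dot F^{-1}([\nu+\tfrac{\alpha}{n}]_\Theta)\big)+nF\big(\dot F^{-1}(\nu)\big),$$ where $[\cdot]_\Theta$ is clipping to $\Theta$. Equivalently,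 $I(\nu,n,\alpha)=n\,g(\nu+\tfrac\alpha n)-n\,g(\nu)$ with $g(x)=x\,\dot F^{-1}([x]_\Theta)-F(\dot F^{-1}([x]_\Theta))$; here $g(x)$ is read, when $[x]_\Theta$ is an endpoint of $\Theta$ not belonging to $\Theta$, as the limit (possibly $+\infty$) of $x\eta-F(\eta)$ as $\eta$ tends to the corresponding end of $\mathcal N$, and the index is $-\infty$ when $g(\nu)=+\infty$. Put $\xi(k;\nu)=I(\nu,k,1)$, $K^*(\theta',\theta'')=\inf\{k>0:\dot F^{-1}(\theta')>\xi(k;\theta'')\}$ and $D(\theta',\theta'')=F(\eta'')-F(\eta')-\dot F(\eta')(\eta''-\eta')$ with $\eta'=\dot F^{-1}(\theta')$, $\eta''=\dot F^{-1}(\theta'')$. Given the past and the arm pulled in a round, the reward is distributed according to that arm. Let $N_i(t)$ and $p_i(t)$ be the number of pulls and the empirical mean reward of arm $i$ after $t$ rounds. The RBMLE policy with bias $\alpha(t)$ first pulls every arm once and afterwards, having completed $t$ rounds, pulls an arm maximizing $I(p_i(t),N_i(t),\alpha(t))$, ties being broken arbitrarily. Its regret is $\mathcal R(T)=T\theta_1-\mathbb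 E\big[\sum_{t=1}^TX_t\big]$. **Proposition.** Let $\varepsilon\in(0,1)$, assume $K^*(\theta_1-\frac\varepsilon2\Delta,\underline\theta)>0$, and let $\alpha(t)=C_\alpha\log t$ with $$C_\alpha\ \ge\ \frac{4}{D(\theta_1-\frac\varepsilon2\Delta,\theta_1)\,K^*(\theta_1-\frac\varepsilon2\Delta,\underline\theta)} .$$ Then the rewards are integrable and, for every $T$ (with $\log 0$ read as $0$) and every $a\ne 1$, $$\mathbb E[N_a(T)]\le Q_a(T)+\frac{\pi^2}{3},\qquad Q_a(T)=\max\Big\{\frac{4}{D(\theta_a+\frac\varepsilon2\Delta_a,\theta_a)},\,C_\alpha K^*\big(\theta_1-\tfrac\varepsilon2\Delta_a,\theta_a+\tfrac\varepsilon2\Delta_a\big)\Big\}\log T+1 .$$ Consequently $$\mathcal R(T)\le\sum_{a\neq1}\Delta_a\Big[\max\Big\{\frac{4}{D(\theta_a+\frac\varepsilon2\Delta_a,\theta_a)},\,C_\alpha K^*\big(\theta_1-\tfrac\varepsilon2\Delta_a,\theta_a+\tfrac\varepsilon2\Delta_a\big)\Big\}\log T+1+\frac{\pi^2}{3}\Big],$$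 and $\mathcal R(T)=O(\log T)$ as $T\to\infty$. -/

import Mathlib

open MeasureTheory ProbabilityTheory Asymptotics Filter
open scoped ENNReal

/-- A one-parameter exponential family in canonical form on the real line: with respect to a fixed
dominating measure (Lebesgue measure, a counting measure, ...) the member with canonical parameter
`η ∈ N` has density `A x * exp (η * x - F η)`. The parameter space `N` is an interval and `F` is
twice differentiable on it. Convexity of `F` and the fact that its derivative is the mean are not
part of the definition: they are consequences. -/
structure ExpFamily where
  /-- the parameter space -/
  N : Set ℝ
  convex_N : Convex ℝ N
  /-- the dominating measure -/
  dom : Measure ℝ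
  A : ℝ → ℝ
  measurable_A : Measurable A
  A_nonneg : ∀ x, 0 ≤ A x
  F : ℝ → ℝ
  isProbabilityMeasure_density : ∀ η ∈ N,
    IsProbabilityMeasure
      (dom.withDensity fun x => ENNReal.ofReal (A x * Real.exp (η * x - F η)))
  differentiable_F : DifferentiableOn ℝ F N
  differentiable_deriv_F : DifferentiableOn ℝ (derivWithin F N) N

namespace ExpFamily

noncomputable section

variable (E : ExpFamily)

/-- The distribution with canonical parameter `η`. -/
def law (η : ℝ) : Measure ℝ :=
  E.dom.withDensity fun x => ENNReal.ofReal (E.A x * Real.exp (η * x - E.F η))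

/-- The mean of the distribution with canonical parameter `η`. -/
def mean (η : ℝ) : ℝ := ∫ x, x ∂(E.law η)

/-- `Ḟ`, the derivative of `F` on the parameter space (one-sided at an endpoint that belongs to the
parameter space). -/
def Fdot (η : ℝ) : ℝ := derivWithin E.F E.N η

/-- `Θ = Ḟ(N)`, the set of possible means. -/
def Theta : Set ℝ := E.Fdot '' E.N

/-- `Ḟ⁻¹ : Θ → N`. -/
def FdotInv (θ : ℝ) : ℝ := Function.invFunOn E.Fdot E.N θ

open Classical in
/-- `[x]_Θ`, the value `x` clipped to the interval `Θ`: a point outside `Θ` is moved to the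
endpoint of `Θ` on its side (which need not belong to `Θ`). -/
def clip (x : ℝ) : ℝ :=
  if x ∈ E.Theta then x
  else if ∀ θ ∈ E.Theta, θ ≤ x then sSup E.Theta
  else sInf E.Theta

open Classical in
/-- `x * Ḟ⁻¹([x]_Θ) - F(Ḟ⁻¹([x]_Θ))`. If the clipped value is an endpoint of `Θ` that does not
belong to `Θ`, where `Ḟ⁻¹` has no value in `N`, the expression is understood as the limit of
`x * η - F η` as `η ∈ N` tends to the corresponding end of `N`; by concavity this limit, possibly
`+∞`, is the supremum over `N`. For Bernoulli rewards this gives the usual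
`0 log 0 = 0` at `x = 0` and `x = 1`. -/
def profile (x : ℝ) : EReal :=
  if E.clip x ∈ E.Theta then
    ((x * E.FdotInv (E.clip x) - E.F (E.FdotInv (E.clip x)) : ℝ) : EReal)
  else ⨆ η ∈ E.N, ((x * η - E.F η : ℝ) : EReal)

/-- The RBMLE index
`I(ν, n, α) = (n ν + α) Ḟ⁻¹([ν + α/n]_Θ) - n ν Ḟ⁻¹(ν) - n F(Ḟ⁻¹([ν + α/n]_Θ)) + n F(Ḟ⁻¹(ν))`,
written as `n * profile (ν + α/n) - n * profile ν` so that it also makes sense at the endpoints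
of `Θ`. -/
def index (ν n α : ℝ) : EReal :=
  (n : EReal) * E.profile (ν + α / n) - (n : EReal) * E.profile ν

/-- When `ν` and the clipped `ν + α/n` are in `Θ`, the index is literally the closed formula. -/
theorem index_eq_formula {ν n α : ℝ} (hn : 0 < n) (hν : ν ∈ E.Theta)
    (hc : E.clip (ν + α / n) ∈ E.Theta) :
    E.index ν n α =
      (((n * ν + α) * E.FdotInv (E.clip (ν + α / n)) - n * ν * E.FdotInv ν
        - n * E.F (E.FdotInv (E.clip (ν + α / n))) + n * E.F (E.FdotInv ν) : ℝ) : EReal) := by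
  have h1 : E.clip ν = ν := by simp [clip, hν]
  have h2 : E.profile ν = ((ν * E.FdotInv ν - E.F (E.FdotInv ν) : ℝ) : EReal) := by
    simp only [profile, h1, hν, if_true]
  unfold index
  rw [h2]
  simp only [profile, hc, if_true]
  norm_cast
  field_simp
  ring

/-- `ξ(k; ν)`, for `k > 0`. -/
def xi (k ν : ℝ) : EReal := E.index ν k 1

/-- `K*(θ', θ'') = inf {k > 0 : Ḟ⁻¹(θ') > ξ(k; θ'')}`. -/
def Kstar (θ' θ'' : ℝ) : ℝ := sInf {k : ℝ | 0 < k ∧ E.xi k θ'' < ((E.FdotInv θ' : ℝ) : EReal)}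

/-- The Kullback--Leibler divergence `F(η'') - [F(η') + Ḟ(η')(η'' - η')]` between the members with
canonical parameters `η'` and `η''`. -/
def KL (η' η'' : ℝ) : ℝ := E.F η'' - (E.F η' + E.Fdot η' * (η'' - η'))

/-- `D(θ', θ'') = KL(Ḟ⁻¹(θ') ‖ Ḟ⁻¹(θ''))`. -/
def D (θ' θ'' : ℝ) : ℝ := E.KL (E.FdotInv θ') (E.FdotInv θ'')

end

end ExpFamily

/-! ### Bandit interaction

Rounds are numbered from `0`: `arm t` and `X t` are the arm pulled and the reward received in the
`(t + 1)`-st round, so that quantities "up to time `t`" involve the rounds `s < t`. -/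

namespace Bandit

noncomputable section

variable {Ω : Type*} {K : ℕ}

/-- `N_i(t)`, the number of pulls of arm `i` in the first `t` rounds. -/
def pulls (arm : ℕ → Ω → Fin K) (i : Fin K) (t : ℕ) (ω : Ω) : ℕ :=
  ((Finset.range t).filter fun s => arm s ω = i).card

/-- `S_i(t)`, the total reward from arm `i` in the first `t` rounds. -/
def total (arm : ℕ → Ω → Fin K) (X : ℕ → Ω → ℝ) (i : Fin K) (t : ℕ) (ω : Ω) : ℝ :=
  ∑ s ∈ (Finset.range t).filter (fun s => arm s ω = i), X s ω

/-- `p_i(t)`, the empirical mean of arm `i` after `t` rounds. -/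
def empMean (arm : ℕ → Ω → Fin K) (X : ℕ → Ω → ℝ) (i : Fin K) (t : ℕ) (ω : Ω) : ℝ :=
  total arm X i t ω / (pulls arm i t ω : ℝ)

/-- The information available when the reward of round `t` is drawn: all earlier arms and
rewards, and the arm pulled in round `t`. -/
@[reducible] def history (arm : ℕ → Ω → Fin K) (X : ℕ → Ω → ℝ) (t : ℕ) : MeasurableSpace Ω :=
  (⨆ s ∈ Finset.range t,
      (MeasurableSpace.comap (arm s) inferInstance ⊔ MeasurableSpace.comap (X s) inferInstance)) ⊔
    MeasurableSpace.comap (arm t) inferInstance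

/-- `arm`, `X` is an interaction with the stochastic bandit whose arms have the reward distributions
`ν i`: given the past and the arm pulled, the reward has the distribution of that arm. -/
structure IsInteraction [MeasurableSpace Ω] (P : Measure Ω) (ν : Fin K → Measure ℝ)
    (arm : ℕ → Ω → Fin K) (X : ℕ → Ω → ℝ) : Prop where
  measurable_arm : ∀ t, Measurable (arm t)
  measurable_X : ∀ t, Measurable (X t)
  cond_law : ∀ t (B : Set ℝ), MeasurableSet B →
    P⟦X t ⁻¹' B | history arm X t⟧ =ᵐ[P] fun ω => (ν (arm t ω)).real B

/-- The arms are chosen by the RBMLE index policy with bias term `α`: arms that have not been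
pulled yet are pulled first (their empirical mean is undefined), and afterwards, with the
data up to time `t`, an arm is pulled whose index `I(p_i(t), N_i(t), α(t))` is largest; ties are
broken in an arbitrary way. -/
def FollowsRBMLE (E : ExpFamily) (α : ℕ → ℝ) (arm : ℕ → Ω → Fin K) (X : ℕ → Ω → ℝ) (ω : Ω) : Prop :=
  ∀ t : ℕ,
    ((∃ i, pulls arm i t ω = 0) → pulls arm (arm t ω) t ω = 0) ∧
    ((∀ i, pulls arm i t ω ≠ 0) → ∀ i,
      E.index (empMean arm X i t ω) (pulls arm i t ω) (α t) ≤
        E.index (empMean arm X (arm t ω) t ω) (pulls arm (arm t ω) t ω) (α t))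

/-- `R(T) = T θ₁ - 𝔼[X_1 + ⋯ + X_T]`, where `best` is the mean of the optimal arm. -/
def regret [MeasurableSpace Ω] (P : Measure Ω) (best : ℝ) (X : ℕ → Ω → ℝ) (T : ℕ) : ℝ :=
  T * best - ∫ ω, ∑ t ∈ Finset.range T, X t ω ∂P

/-- `Δ_a`, the gap of arm `a` with respect to the arm `b`. -/
def gap (θ : Fin K → ℝ) (b a : Fin K) : ℝ := θ b - θ a

/-- `Δ`, the minimum gap over the arms other than `b`. -/
def minGap (θ : Fin K → ℝ) (b : Fin K) : ℝ := ⨅ a : {a : Fin K // a ≠ b}, gap θ b a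

/-- `max {4 / D(θ_a + ε Δ_a / 2, θ_a), C_α K*(θ₁ - ε Δ_a / 2, θ_a + ε Δ_a / 2)}`. -/
def coeff (E : ExpFamily) (θ : Fin K → ℝ) (b : Fin K) (ε C : ℝ) (a : Fin K) : ℝ :=
  max (4 / E.D (θ a + ε / 2 * gap θ b a) (θ a))
    (C * E.Kstar (θ b - ε / 2 * gap θ b a) (θ a + ε / 2 * gap θ b a))

/-- `Q_a(T)`. -/
def Q (E : ExpFamily) (θ : Fin K → ℝ) (b : Fin K) (ε C : ℝ) (a : Fin K) (T : ℕ) : ℝ :=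
  coeff E θ b ε C a * Real.log T + 1

end

end Bandit

/-! ### Exponential tilting, the mean and the divergence -/

namespace ExpFamily

variable {E : ExpFamily}

/-! Let g be the convex conjugate of F. The index n (g(ν + α/n) - g(ν)) is a scaled increment of a
convex function: it grows with ν (`index_le_index`) and equals α ξ(n/α; ν) (`index_eq_mul_xi`),
where ξ(k; ν) is the slope of g over a step 1/k and so decreases in k. Thus K* is the value of n/α
at which the index crosses the level α Ḟ⁻¹(θ').

Fix a suboptimal arm a, the optimal arm b and θ_a < θup < θmid ≤ θdn < θ_b. If a was pulled more
than α K*(θmid, θup) times and its empirical mean is at most θup, its index is below α Ḟ⁻¹(θmid).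
The index of b is at least α Ḟ⁻¹(θdn) in two cases: b was pulled fewer than α K*(θdn, θlow) times,
when an empirical mean above θlow suffices, or its empirical mean is at least θdn, because Ḟ⁻¹ is a
subgradient of g (`index_lt_index`). The condition on C makes the first case cover all counts below
4 log t / D. Hence a pull of a after c log T pulls forces one of the two arms to deviate after at
least 4 log t / D pulls.

Each deviation has probability at most 1/t²: the likelihood ratio of the arm's rewards against the
member at the threshold has expectation one under any policy, and Markov's inequality applies at the
random pull count (`measure_deviation_le`). Summing 2/t² gives π²/3. Convexity of F and the identity
between mean and Ḟ are derived from integrals of tilted densities. -/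

theorem isProbabilityMeasure_law {η : ℝ} (hη : η ∈ E.N) : IsProbabilityMeasure (E.law η) :=
  E.isProbabilityMeasure_density η hη

theorem law_eq_withDensity (E : ExpFamily) (η η' : ℝ) :
    E.law η' = (E.law η).withDensity
      fun x => ENNReal.ofReal (Real.exp ((η' - η) * x - (E.F η' - E.F η))) := by
  have hA := E.measurable_A
  unfold law
  rw [← withDensity_mul _ (by fun_prop) (by fun_prop)]
  congr 1
  ext x
  rw [Pi.mul_apply, ← ENNReal.ofReal_mul (mul_nonneg (E.A_nonneg x) (Real.exp_pos _).le), mul_assoc,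
    ← Real.exp_add]
  ring_nf

theorem law_absolutelyContinuous (E : ExpFamily) (η η' : ℝ) : E.law η' ≪ E.law η := by
  rw [E.law_eq_withDensity η η']
  exact withDensity_absolutelyContinuous _ _

theorem lintegral_exp_sub_mul {η η' : ℝ} (hη' : η' ∈ E.N) :
    ∫⁻ x, ENNReal.ofReal (Real.exp ((η' - η) * x - (E.F η' - E.F η))) ∂(E.law η) = 1 := by
  have := isProbabilityMeasure_law hη'
  have h : E.law η' Set.univ = 1 := measure_univ
  rwa [E.law_eq_withDensity η η', withDensity_apply _ MeasurableSet.univ,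
    Measure.restrict_univ] at h

theorem integrable_exp_sub_mul_sub {η η' : ℝ} (hη' : η' ∈ E.N) :
    Integrable (fun x => Real.exp ((η' - η) * x - (E.F η' - E.F η))) (E.law η) := by
  refine ⟨by fun_prop, ?_⟩
  rw [hasFiniteIntegral_iff_ofReal (ae_of_all _ fun x => (Real.exp_pos _).le),
    lintegral_exp_sub_mul hη']
  exact ENNReal.one_lt_top

theorem integral_exp_sub_mul_sub {η η' : ℝ} (hη' : η' ∈ E.N) :
    ∫ x, Real.exp ((η' - η) * x - (E.F η' - E.F η)) ∂(E.law η) = 1 := by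
  rw [integral_eq_lintegral_of_nonneg_ae (ae_of_all _ fun x => (Real.exp_pos _).le) (by fun_prop),
    lintegral_exp_sub_mul hη', ENNReal.toReal_one]

theorem integrable_exp_sub_mul {η η' : ℝ} (hη' : η' ∈ E.N) :
    Integrable (fun x => Real.exp ((η' - η) * x)) (E.law η) := by
  refine ((integrable_exp_sub_mul_sub (η := η) hη').const_mul
    (Real.exp (E.F η' - E.F η))).congr (ae_of_all _ fun x => ?_)
  simp only
  rw [← Real.exp_add]
  ring_nf

theorem integral_exp_sub_mul {η η' : ℝ} (hη' : η' ∈ E.N) :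
    ∫ x, Real.exp ((η' - η) * x) ∂(E.law η) = Real.exp (E.F η' - E.F η) := by
  have h := congrArg (Real.exp (E.F η' - E.F η) * ·) (integral_exp_sub_mul_sub (η := η) hη')
  simp only [mul_one] at h
  rw [← integral_const_mul] at h
  rw [← h]
  congr 1
  ext x
  rw [← Real.exp_add]
  ring_nf

/-- The difference quotients `(e^{s y} - 1) / s` increase with `s > 0`. -/
theorem exp_slope_mono (y : ℝ) {s t : ℝ} (hs : 0 < s) (hst : s ≤ t) :
    (Real.exp (s * y) - 1) / s ≤ (Real.exp (t * y) - 1) / t := by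
  have ht := hs.trans_le hst
  rw [div_le_div_iff₀ hs ht]
  have hc := convexOn_exp.2 (Set.mem_univ (t * y)) (Set.mem_univ (0 : ℝ))
    (show 0 ≤ s / t by positivity)
    (show 0 ≤ 1 - s / t by rw [sub_nonneg, div_le_one ht]; exact hst) (by ring)
  have e : (s / t) • (t * y) + (1 - s / t) • (0 : ℝ) = s * y := by
    simp only [smul_eq_mul]; field_simp; ring
  rw [e] at hc
  simp only [smul_eq_mul, Real.exp_zero] at hc
  have h2 := mul_le_mul_of_nonneg_left hc ht.le
  have e2 : t * (s / t * Real.exp (t * y) + (1 - s / t) * 1) = s * Real.exp (t * y) + (t - s) := by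
    field_simp
  rw [e2] at h2
  linarith

theorem tendsto_exp_slope (y : ℝ) {u : ℕ → ℝ} (hu : Tendsto u atTop (nhdsWithin 0 {0}ᶜ)) :
    Tendsto (fun n => (Real.exp (u n * y) - 1) / u n) atTop (nhds y) := by
  have h : HasDerivAt (fun s : ℝ => Real.exp (s * y)) (Real.exp (0 * y) * (1 * y)) 0 :=
    ((hasDerivAt_id (0 : ℝ)).mul_const y).exp
  simp only [zero_mul, Real.exp_zero, one_mul] at h
  refine (h.tendsto_slope.comp hu).congr fun n => ?_
  simp [slope_def_field]

theorem hasDerivWithinAt_F {η : ℝ} (hη : η ∈ E.N) : HasDerivWithinAt E.F (E.Fdot η) E.N η :=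
  (E.differentiable_F η hη).hasDerivWithinAt

theorem mem_segment_N {η η' s : ℝ} (hη : η ∈ E.N) (hη' : η' ∈ E.N) (h0 : 0 ≤ s) (h1 : s ≤ 1) :
    η + s * (η' - η) ∈ E.N := by
  have := E.convex_N hη hη' (sub_nonneg.2 h1) h0 (by ring)
  simp only [smul_eq_mul] at this
  convert this using 1; ring

/-- The derivative is taken only along the segment towards η', so η may be an endpoint of the
parameter space. -/
theorem tendsto_exp_F_slope {η η' : ℝ} (hη : η ∈ E.N) (hη' : η' ∈ E.N) (hne : η' ≠ η)
    {u : ℕ → ℝ} (hu : Tendsto u atTop (nhds 0)) (h0 : ∀ n, 0 < u n) (h1 : ∀ n, u n ≤ 1) :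
    Tendsto (fun n => (Real.exp (E.F (η + u n * (η' - η)) - E.F η) - 1) / u n) atTop
      (nhds ((η' - η) * E.Fdot η)) := by
  have h : HasDerivWithinAt (fun z => Real.exp (E.F z - E.F η))
      (Real.exp (E.F η - E.F η) * E.Fdot η) E.N η := ((hasDerivWithinAt_F hη).sub_const _).exp
  rw [sub_self, Real.exp_zero, one_mul, hasDerivWithinAt_iff_tendsto_slope] at h
  have hd : η' - η ≠ 0 := sub_ne_zero.2 hne
  have hu' : Tendsto (fun n => η + u n * (η' - η)) atTop (nhdsWithin η (E.N \ {η})) := by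
    refine tendsto_nhdsWithin_iff.2 ⟨?_, Eventually.of_forall fun n => ⟨?_, ?_⟩⟩
    · simpa using (hu.mul_const (η' - η)).const_add η
    · exact mem_segment_N hη hη' (h0 n).le (h1 n)
    · simp [hd, (h0 n).ne']
  refine ((h.comp hu').const_mul (η' - η)).congr fun n => ?_
  have := (h0 n).ne'
  simp only [Function.comp_apply, slope_def_field, sub_self, Real.exp_zero, add_sub_cancel_left]
  field_simp

theorem integrable_exp_sub_mul_sub_one {η η' : ℝ} (hη : η ∈ E.N) (hη' : η' ∈ E.N) :
    Integrable (fun x => Real.exp ((η' - η) * x) - 1) (E.law η) :=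
  have := isProbabilityMeasure_law hη
  (integrable_exp_sub_mul hη').sub (integrable_const 1)

theorem integral_exp_sub_mul_sub_one {η η' : ℝ} (hη : η ∈ E.N) (hη' : η' ∈ E.N) :
    ∫ x, (Real.exp ((η' - η) * x) - 1) ∂(E.law η) = Real.exp (E.F η' - E.F η) - 1 := by
  have := isProbabilityMeasure_law hη
  rw [integral_sub (integrable_exp_sub_mul hη') (integrable_const _), integral_exp_sub_mul hη']
  simp

/-- Differentiation under the integral by monotone convergence. With d = η' - η, the functions
(e^{dx} - 1) - (e^{udx} - 1)/u are nonnegative and increase to e^{dx} - 1 - dx as u decreases to 0;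
their integrals are explicit in F and converge. This yields integrability as well as the value. -/
theorem integral_mul_law {η η' : ℝ} (hη : η ∈ E.N) (hη' : η' ∈ E.N) (hne : η' ≠ η) :
    Integrable (fun x => (η' - η) * x) (E.law η) ∧
      ∫ x, (η' - η) * x ∂(E.law η) = (η' - η) * E.Fdot η := by
  have := isProbabilityMeasure_law hη
  set d := η' - η with hd
  set u : ℕ → ℝ := fun n => 1 / ((n : ℝ) + 1) with hu
  have hu0 : ∀ n, 0 < u n := fun n => by positivity
  have hu1 : ∀ n, u n ≤ 1 := fun n => by
    simp only [hu]; rw [div_le_one (by positivity)]; linarith [(Nat.cast_nonneg n : (0 : ℝ) ≤ n)]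
  have hut : Tendsto u atTop (nhds 0) := tendsto_one_div_add_atTop_nhds_zero_nat
  have hua : Antitone u := fun m n h => by
    simp only [hu]; gcongr
  have hut' : Tendsto u atTop (nhdsWithin 0 {0}ᶜ) :=
    tendsto_nhdsWithin_iff.2 ⟨hut, Eventually.of_forall fun n => (hu0 n).ne'⟩
  set φ : ℕ → ℝ → ℝ := fun n x => (Real.exp (d * x) - 1) - (Real.exp (u n * (d * x)) - 1) / u n
    with hφ
  set c : ℕ → ℝ := fun n => (Real.exp (E.F η' - E.F η) - 1) -
    (Real.exp (E.F (η + u n * d) - E.F η) - 1) / u n with hc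
  have hI : ∀ n, Integrable (φ n) (E.law η) ∧ ∫ x, φ n x ∂(E.law η) = c n := by
    intro n
    have hm := mem_segment_N hη hη' (hu0 n).le (hu1 n)
    have e : ∀ x, u n * (d * x) = (η + u n * d - η) * x := fun x => by ring
    have i1 := integrable_exp_sub_mul_sub_one hη hη'
    have i2 := (integrable_exp_sub_mul_sub_one hη hm).div_const (u n)
    simp only [hφ, hc, e]
    refine ⟨i1.sub i2, ?_⟩
    rw [integral_sub i1 i2, integral_div, integral_exp_sub_mul_sub_one hη hm,
      integral_exp_sub_mul_sub_one hη hη']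
  have hφ0 : ∀ n x, 0 ≤ φ n x := fun n x => by
    have := exp_slope_mono (d * x) (hu0 n) (hu1 n)
    simp only [one_mul, div_one] at this
    simp only [hφ]; linarith
  have hφm : ∀ x, Monotone fun n => φ n x := fun x m n h => by
    have := exp_slope_mono (d * x) (hu0 n) (hua h)
    simp only [hφ]; linarith
  have hφt : ∀ x, Tendsto (fun n => φ n x) atTop (nhds ((Real.exp (d * x) - 1) - d * x)) :=
    fun x => (tendsto_exp_slope (d * x) hut').const_sub _
  have hct : Tendsto c atTop (nhds ((Real.exp (E.F η' - E.F η) - 1) - d * E.Fdot η)) :=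
    (tendsto_exp_F_slope hη hη' hne hut hu0 hu1).const_sub _
  have hlim0 : ∀ x, 0 ≤ (Real.exp (d * x) - 1) - d * x := fun x => by
    linarith [Real.add_one_le_exp (d * x)]
  have hlint : ∫⁻ x, ENNReal.ofReal ((Real.exp (d * x) - 1) - d * x) ∂(E.law η) =
      ENNReal.ofReal ((Real.exp (E.F η' - E.F η) - 1) - d * E.Fdot η) := by
    refine tendsto_nhds_unique (lintegral_tendsto_of_tendsto_of_monotone
      (f := fun n x => ENNReal.ofReal (φ n x)) (fun n => by fun_prop)
      (ae_of_all _ fun x m n h => ENNReal.ofReal_le_ofReal (hφm x h))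
      (ae_of_all _ fun x => ENNReal.tendsto_ofReal (hφt x))) ?_
    refine (ENNReal.tendsto_ofReal hct).congr fun n => ?_
    rw [← (hI n).2, ofReal_integral_eq_lintegral_ofReal (hI n).1 (ae_of_all _ (hφ0 n))]
  have hint : Integrable (fun x => (Real.exp (d * x) - 1) - d * x) (E.law η) := by
    refine ⟨by fun_prop, ?_⟩
    rw [hasFiniteIntegral_iff_ofReal (ae_of_all _ hlim0), hlint]
    exact ENNReal.ofReal_lt_top
  have hval : ∫ x, ((Real.exp (d * x) - 1) - d * x) ∂(E.law η) =
      (Real.exp (E.F η' - E.F η) - 1) - d * E.Fdot η := by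
    rw [integral_eq_lintegral_of_nonneg_ae (ae_of_all _ hlim0) hint.1, hlint,
      ENNReal.toReal_ofReal]
    refine ge_of_tendsto' hct fun n => ?_
    rw [← (hI n).2]
    exact integral_nonneg (hφ0 n)
  have i1 := integrable_exp_sub_mul_sub_one hη hη'
  have e : (fun x => d * x) =
      fun x => (Real.exp ((η' - η) * x) - 1) - ((Real.exp (d * x) - 1) - d * x) := by
    ext x; simp only [hd]; ring
  rw [e]
  refine ⟨i1.sub hint, ?_⟩
  rw [integral_sub i1 hint, hval, integral_exp_sub_mul_sub_one hη hη']
  ring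

theorem integrable_id_law (hN : E.N.Nontrivial) {η : ℝ} (hη : η ∈ E.N) :
    Integrable (fun x => x) (E.law η) := by
  obtain ⟨η', hη', hne⟩ := hN.exists_ne η
  refine ((integral_mul_law hη hη' hne).1.const_mul (η' - η)⁻¹).congr (ae_of_all _ fun x => ?_)
  exact inv_mul_cancel_left₀ (sub_ne_zero.2 hne) x

theorem mean_eq_Fdot (hN : E.N.Nontrivial) {η : ℝ} (hη : η ∈ E.N) : E.mean η = E.Fdot η := by
  obtain ⟨η', hη', hne⟩ := hN.exists_ne η
  have h := (integral_mul_law hη hη' hne).2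
  rw [integral_const_mul] at h
  exact mul_left_cancel₀ (sub_ne_zero.2 hne) h

/-- The moment generating function of the centred reward is e^KL. Subtracting the mean-one linear
part leaves a nonnegative integrand, so both the sign of KL and its equality case can be read off.
-/
theorem integral_exp_sub_mul_mean {η η' : ℝ} (hN : E.N.Nontrivial) (hη : η ∈ E.N)
    (hη' : η' ∈ E.N) :
    Integrable (fun x => Real.exp ((η' - η) * (x - E.Fdot η)) - ((η' - η) * (x - E.Fdot η) + 1))
      (E.law η) ∧
    ∫ x, (Real.exp ((η' - η) * (x - E.Fdot η)) - ((η' - η) * (x - E.Fdot η) + 1)) ∂(E.law η) =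
      Real.exp (E.KL η η') - 1 := by
  have := isProbabilityMeasure_law hη
  have hid := integrable_id_law hN hη
  have e : ∀ x, Real.exp ((η' - η) * (x - E.Fdot η)) =
      Real.exp ((η' - η) * x) * Real.exp (-((η' - η) * E.Fdot η)) := fun x => by
    rw [← Real.exp_add]; ring_nf
  have i1 := (integrable_exp_sub_mul (η := η) hη').mul_const (Real.exp (-((η' - η) * E.Fdot η)))
  have i3 : Integrable (fun x => (η' - η) * (x - E.Fdot η)) (E.law η) :=
    (hid.sub (integrable_const _)).const_mul _
  have i2 : Integrable (fun x => (η' - η) * (x - E.Fdot η) + 1) (E.law η) :=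
    i3.add (integrable_const _)
  simp only [e]
  refine ⟨i1.sub i2, ?_⟩
  rw [integral_sub i1 i2]
  have e2 : ∫ x, ((η' - η) * (x - E.Fdot η) + 1) ∂(E.law η) = 1 := by
    rw [integral_add i3 (integrable_const _), integral_const_mul,
      integral_sub hid (integrable_const _)]
    have := mean_eq_Fdot hN hη
    unfold mean at this
    rw [this]
    simp
  have e3 : ∫ x, Real.exp ((η' - η) * x) * Real.exp (-((η' - η) * E.Fdot η)) ∂(E.law η) =
      Real.exp (E.KL η η') := by
    rw [integral_mul_const, integral_exp_sub_mul hη', ← Real.exp_add]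
    unfold KL
    ring_nf
  rw [e3, e2]

theorem KL_nonneg (hN : E.N.Nontrivial) {η η' : ℝ} (hη : η ∈ E.N) (hη' : η' ∈ E.N) :
    0 ≤ E.KL η η' := by
  rw [← Real.one_le_exp_iff, ← sub_nonneg, ← (integral_exp_sub_mul_mean hN hη hη').2]
  exact integral_nonneg fun x => sub_nonneg.2 (Real.add_one_le_exp _)

/-- If the mean is not constant on the parameter space, then distinct members have positive
divergence. -/
theorem KL_pos (hT : E.Theta.Nontrivial) {η η' : ℝ} (hη : η ∈ E.N) (hη' : η' ∈ E.N)
    (hne : η' ≠ η) : 0 < E.KL η η' := by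
  have hN : E.N.Nontrivial := Set.nontrivial_of_image _ _ hT
  refine (KL_nonneg hN hη hη').lt_of_ne fun h0 => ?_
  obtain ⟨hi, hv⟩ := integral_exp_sub_mul_mean hN hη hη'
  rw [← h0, Real.exp_zero, sub_self,
    integral_eq_zero_iff_of_nonneg (fun x => sub_nonneg.2 (Real.add_one_le_exp _)) hi] at hv
  -- Zero divergence makes the reward almost surely constant; by absolute continuity it is the same
  -- constant under every member, and Θ is a single point.
  have hc : ∀ᵐ x ∂(E.law η), x = E.Fdot η := by
    filter_upwards [hv] with x hx
    by_contra hxne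
    have := Real.add_one_lt_exp (mul_ne_zero (sub_ne_zero.2 hne) (sub_ne_zero.2 hxne))
    simp only [Pi.zero_apply] at hx
    linarith
  refine hT.not_subsingleton ((Set.subsingleton_singleton (a := E.Fdot η)).anti ?_)
  rintro _ ⟨ζ, hζ, rfl⟩
  have := isProbabilityMeasure_law hζ
  rw [Set.mem_singleton_iff, ← mean_eq_Fdot hN hζ, mean,
    integral_congr_ae ((law_absolutelyContinuous E η ζ).ae_le hc)]
  simp

theorem KL_add_KL (η η' : ℝ) :
    E.KL η η' + E.KL η' η = (E.Fdot η' - E.Fdot η) * (η' - η) := by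
  unfold KL; ring

theorem strictMonoOn_Fdot (hT : E.Theta.Nontrivial) : StrictMonoOn E.Fdot E.N := by
  intro η hη η' hη' hlt
  have h := add_pos (KL_pos hT hη hη' hlt.ne') (KL_pos hT hη' hη hlt.ne)
  rw [KL_add_KL] at h
  exact sub_pos.1 (pos_of_mul_pos_left h (sub_pos.2 hlt).le)

/-- Twice differentiability of F enters here, through continuity of Ḟ on an interval. -/
theorem ordConnected_Theta : E.Theta.OrdConnected :=
  (E.convex_N.isPreconnected.image _ E.differentiable_deriv_F.continuousOn).ordConnected

theorem FdotInv_mem {θ : ℝ} (h : θ ∈ E.Theta) : E.FdotInv θ ∈ E.N := Function.invFunOn_mem h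

theorem Fdot_FdotInv {θ : ℝ} (h : θ ∈ E.Theta) : E.Fdot (E.FdotInv θ) = θ :=
  Function.invFunOn_eq h

theorem FdotInv_Fdot (hT : E.Theta.Nontrivial) {η : ℝ} (h : η ∈ E.N) :
    E.FdotInv (E.Fdot η) = η :=
  (strictMonoOn_Fdot hT).injOn.leftInvOn_invFunOn h

theorem strictMonoOn_FdotInv (hT : E.Theta.Nontrivial) : StrictMonoOn E.FdotInv E.Theta := by
  intro θ hθ θ' hθ' hlt
  rwa [← (strictMonoOn_Fdot hT).lt_iff_lt (FdotInv_mem hθ) (FdotInv_mem hθ'), Fdot_FdotInv hθ,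
    Fdot_FdotInv hθ']

theorem D_pos (hT : E.Theta.Nontrivial) {θ θ' : ℝ} (hθ : θ ∈ E.Theta) (hθ' : θ' ∈ E.Theta)
    (hne : θ ≠ θ') : 0 < E.D θ θ' :=
  KL_pos hT (FdotInv_mem hθ) (FdotInv_mem hθ')
    ((strictMonoOn_FdotInv hT).injOn.ne hθ' hθ hne.symm)

end ExpFamily

/-! ### The convex conjugate and the index -/

namespace ExpFamily

variable {E : ExpFamily}

theorem clip_of_mem {x : ℝ} (hx : x ∈ E.Theta) : E.clip x = x := by simp [clip, hx]

theorem profile_of_mem {x : ℝ} (hx : x ∈ E.Theta) :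
    E.profile x = ((x * E.FdotInv x - E.F (E.FdotInv x) : ℝ) : EReal) := by
  simp [profile, clip_of_mem hx, hx]

theorem sub_le_of_clip_mem (hT : E.Theta.Nontrivial) {x η : ℝ} (hc : E.clip x ∈ E.Theta)
    (hη : η ∈ E.N) :
    x * η - E.F η ≤ x * E.FdotInv (E.clip x) - E.F (E.FdotInv (E.clip x)) := by
  have hN : E.N.Nontrivial := Set.nontrivial_of_image _ _ hT
  have hm := FdotInv_mem hc
  have hF := Fdot_FdotInv hc
  have hKL := KL_nonneg hN hm hη
  unfold KL at hKL
  rw [hF] at hKL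
  have hmem : E.Fdot η ∈ E.Theta := ⟨η, hη, rfl⟩
  have hmono := (strictMonoOn_Fdot hT).le_iff_le hη hm
  have hmono' := (strictMonoOn_Fdot hT).le_iff_le hm hη
  rw [hF] at hmono hmono'
  -- Nonnegativity of KL is the claim with slope `clip x` instead of x; this product is the
  -- correction. If x lies beyond an end of Θ, the maximiser is the extreme parameter on that side,
  -- which fixes the sign.
  suffices (x - E.clip x) * (η - E.FdotInv (E.clip x)) ≤ 0 by nlinarith
  by_cases hx : x ∈ E.Theta
  · simp [clip_of_mem hx]
  by_cases hx2 : ∀ θ ∈ E.Theta, θ ≤ x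
  · have hcx : E.clip x = sSup E.Theta := by rw [clip, if_neg hx, if_pos hx2]
    have h1 := hmono.1 (hcx ▸ le_csSup ⟨x, hx2⟩ hmem)
    have h2 := hx2 _ hc
    nlinarith
  · have hcx : E.clip x = sInf E.Theta := by rw [clip, if_neg hx, if_neg hx2]
    obtain ⟨θ₀, hθ₀, hlt⟩ := by push Not at hx2; exact hx2
    have hlow : ∀ θ ∈ E.Theta, x ≤ θ := fun θ hθ => by
      by_contra! h
      exact hx (ordConnected_Theta.out hθ hθ₀ ⟨h.le, hlt.le⟩)
    have h1 := hmono'.1 (hcx ▸ csInf_le ⟨x, hlow⟩ hmem)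
    have h2 := hlow _ hc
    nlinarith

/-- `profile` is the convex conjugate of `F`. -/
theorem profile_eq_iSup (hT : E.Theta.Nontrivial) (x : ℝ) :
    E.profile x = ⨆ η ∈ E.N, ((x * η - E.F η : ℝ) : EReal) := by
  unfold profile
  split_ifs with hc
  · exact le_antisymm
      (le_iSup₂ (f := fun η (_ : η ∈ E.N) => ((x * η - E.F η : ℝ) : EReal)) _ (FdotInv_mem hc))
      (iSup₂_le fun η hη => EReal.coe_le_coe_iff.2 (sub_le_of_clip_mem hT hc hη))
  · rfl

theorem le_profile (hT : E.Theta.Nontrivial) (x : ℝ) {η : ℝ} (hη : η ∈ E.N) :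
    ((x * η - E.F η : ℝ) : EReal) ≤ E.profile x := by
  rw [profile_eq_iSup hT]
  exact le_iSup₂ (f := fun η (_ : η ∈ E.N) => ((x * η - E.F η : ℝ) : EReal)) _ hη

theorem profile_le (hT : E.Theta.Nontrivial) {x c : ℝ} (h : ∀ η ∈ E.N, x * η - E.F η ≤ c) :
    E.profile x ≤ (c : EReal) := by
  rw [profile_eq_iSup hT]
  exact iSup₂_le fun η hη => EReal.coe_le_coe_iff.2 (h η hη)

theorem profile_ne_bot (hT : E.Theta.Nontrivial) (x : ℝ) : E.profile x ≠ ⊥ := by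
  obtain ⟨_, η, hη, rfl⟩ := hT.nonempty
  exact ((EReal.bot_lt_coe _).trans_le (le_profile hT x hη)).ne'

theorem profile_ne_top_of_le (hT : E.Theta.Nontrivial) {x c : ℝ}
    (h : ∀ η ∈ E.N, x * η - E.F η ≤ c) : E.profile x ≠ ⊤ :=
  ((profile_le hT h).trans_lt (EReal.coe_lt_top c)).ne

theorem exists_profile_eq_coe (hT : E.Theta.Nontrivial) {x : ℝ} (h : E.profile x ≠ ⊤) :
    ∃ r : ℝ, E.profile x = r :=
  ⟨(E.profile x).toReal, (EReal.coe_toReal h (profile_ne_bot hT x)).symm⟩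

theorem le_of_profile_eq (hT : E.Theta.Nontrivial) {x r η : ℝ} (h : E.profile x = r)
    (hη : η ∈ E.N) : x * η - E.F η ≤ r := by
  have := le_profile hT x hη
  rwa [h, EReal.coe_le_coe_iff] at this

theorem profile_ne_top_of_mem {x : ℝ} (hx : x ∈ E.Theta) : E.profile x ≠ ⊤ := by
  rw [profile_of_mem hx]; exact EReal.coe_ne_top _

theorem convex_profile_ne_top (hT : E.Theta.Nontrivial) : Convex ℝ {x | E.profile x ≠ ⊤} := by
  intro x hx y hy a b ha hb hab
  obtain ⟨r, hr⟩ := exists_profile_eq_coe hT hx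
  obtain ⟨s, hs⟩ := exists_profile_eq_coe hT hy
  refine profile_ne_top_of_le hT (c := a * r + b * s) fun η hη => ?_
  have h1 := mul_le_mul_of_nonneg_left (le_of_profile_eq hT hr hη) ha
  have h2 := mul_le_mul_of_nonneg_left (le_of_profile_eq hT hs hη) hb
  have h3 : E.F η = a * E.F η + b * E.F η := by rw [← add_mul, hab, one_mul]
  simp only [smul_eq_mul]
  nlinarith

/-- Increments of the profile are monotone. -/
theorem profile_increment (hT : E.Theta.Nontrivial) {θ p h c d : ℝ} (hθp : θ ≤ p) (hh : 0 ≤ h)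
    (hc : E.profile θ = c) (hd : E.profile (p + h) = d) :
    ∃ a b : ℝ, E.profile p = a ∧ E.profile (θ + h) = b ∧ a + b ≤ c + d := by
  -- Rearrangement: the larger of η₁, η₂ is evaluated at p + h and the smaller at θ.
  have key : ∀ η₁ ∈ E.N, ∀ η₂ ∈ E.N,
      (p * η₁ - E.F η₁) + ((θ + h) * η₂ - E.F η₂) ≤ c + d := by
    intro η₁ h₁ η₂ h₂
    have c1 := le_of_profile_eq hT hc h₁
    have c2 := le_of_profile_eq hT hc h₂
    have d1 := le_of_profile_eq hT hd h₁
    have d2 := le_of_profile_eq hT hd h₂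
    rcases le_total η₁ η₂ with hle | hle
    · nlinarith [mul_nonneg (sub_nonneg.2 hθp) (sub_nonneg.2 hle)]
    · nlinarith [mul_nonneg hh (sub_nonneg.2 hle)]
  obtain ⟨_, η₀, h₀, rfl⟩ := hT.nonempty
  obtain ⟨a, ha⟩ := exists_profile_eq_coe hT (profile_ne_top_of_le hT (x := p)
    (c := c + d - ((θ + h) * η₀ - E.F η₀)) fun η hη => by linarith [key η hη η₀ h₀])
  have hle : ∀ η ∈ E.N, (θ + h) * η - E.F η ≤ c + d - a := fun η hη => by
    have := profile_le hT (x := p) (c := c + d - ((θ + h) * η - E.F η))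
      fun η' hη' => by linarith [key η' hη' η hη]
    rw [ha, EReal.coe_le_coe_iff] at this
    linarith
  obtain ⟨b, hb⟩ := exists_profile_eq_coe hT (profile_ne_top_of_le hT hle)
  have := profile_le hT hle
  rw [hb, EReal.coe_le_coe_iff] at this
  exact ⟨a, b, ha, hb, by linarith⟩

theorem index_of_coe {ν n α r s : ℝ} (hr : E.profile ν = r) (hs : E.profile (ν + α / n) = s) :
    E.index ν n α = ((n * (s - r) : ℝ) : EReal) := by
  unfold index
  rw [hr, hs, mul_sub]
  norm_cast

theorem index_of_coe_top {ν n α r : ℝ} (hn : 0 < n) (hr : E.profile ν = r)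
    (hs : E.profile (ν + α / n) = ⊤) : E.index ν n α = ⊤ := by
  unfold index
  rw [hr, hs, EReal.coe_mul_top_of_pos hn, ← EReal.coe_mul, EReal.top_sub_coe]

theorem index_of_top {ν n α : ℝ} (hn : 0 < n) (hr : E.profile ν = ⊤) : E.index ν n α = ⊥ := by
  unfold index
  rw [hr, EReal.coe_mul_top_of_pos hn, EReal.sub_top]

/-- Increments of a convex function grow with the base point. Finiteness at p matters, since
otherwise the index there is -∞. -/
theorem index_le_index (hT : E.Theta.Nontrivial) {θ p n α : ℝ} (hn : 0 < n) (hα : 0 ≤ α)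
    (hθp : θ ≤ p) (hp : E.profile p ≠ ⊤) : E.index θ n α ≤ E.index p n α := by
  by_cases hθ : E.profile θ = ⊤
  · rw [index_of_top hn hθ]; exact bot_le
  obtain ⟨c, hc⟩ := exists_profile_eq_coe hT hθ
  obtain ⟨r, hr⟩ := exists_profile_eq_coe hT hp
  by_cases hd : E.profile (p + α / n) = ⊤
  · rw [index_of_coe_top hn hr hd]; exact le_top
  obtain ⟨d, hd⟩ := exists_profile_eq_coe hT hd
  obtain ⟨a, b, ha, hb, hab⟩ := profile_increment hT hθp (div_nonneg hα hn.le) hc hd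
  rw [index_of_coe hc hb, index_of_coe ha hd, EReal.coe_le_coe_iff]
  exact mul_le_mul_of_nonneg_left (by linarith) hn.le

theorem index_eq_mul_xi (hT : E.Theta.Nontrivial) {ν n α : ℝ} (hn : 0 < n) (hα : 0 < α) :
    E.index ν n α = (α : EReal) * E.xi (n / α) ν := by
  have hk : 0 < n / α := div_pos hn hα
  have e : ν + 1 / (n / α) = ν + α / n := by rw [one_div_div]
  unfold xi
  by_cases hr : E.profile ν = ⊤
  · rw [index_of_top hn hr, index_of_top hk hr, EReal.coe_mul_bot_of_pos hα]
  obtain ⟨r, hr⟩ := exists_profile_eq_coe hT hr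
  by_cases hs : E.profile (ν + α / n) = ⊤
  · rw [index_of_coe_top hn hr hs, index_of_coe_top hk hr (e ▸ hs), EReal.coe_mul_top_of_pos hα]
  obtain ⟨s, hs⟩ := exists_profile_eq_coe hT hs
  rw [index_of_coe hr hs, index_of_coe hr (e ▸ hs), ← EReal.coe_mul, EReal.coe_eq_coe_iff]
  field_simp

/-- Secant slopes of a convex function from ν increase with the step, here 1/k. -/
theorem xi_anti (hT : E.Theta.Nontrivial) {ν k k' : ℝ} (hk : 0 < k) (hkk : k ≤ k') :
    E.xi k' ν ≤ E.xi k ν := by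
  have hk' := hk.trans_le hkk
  unfold xi
  by_cases hr : E.profile ν = ⊤
  · rw [index_of_top hk' hr]; exact bot_le
  obtain ⟨r, hr⟩ := exists_profile_eq_coe hT hr
  by_cases hs : E.profile (ν + 1 / k) = ⊤
  · rw [index_of_coe_top hk hr hs]; exact le_top
  obtain ⟨s, hs⟩ := exists_profile_eq_coe hT hs
  have hle : ∀ η ∈ E.N, (ν + 1 / k') * η - E.F η ≤ r + k / k' * (s - r) := fun η hη => by
    have h1 := le_of_profile_eq hT hr hη
    have h2 := le_of_profile_eq hT hs hη
    have l0 : 0 ≤ k / k' := by positivity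
    have l1 : 0 ≤ 1 - k / k' := sub_nonneg.2 ((div_le_one hk').2 hkk)
    have e : (ν + 1 / k') * η - E.F η =
        (1 - k / k') * (ν * η - E.F η) + k / k' * ((ν + 1 / k) * η - E.F η) := by
      field_simp; ring
    rw [e]
    linarith [mul_le_mul_of_nonneg_left h1 l1, mul_le_mul_of_nonneg_left h2 l0]
  obtain ⟨b, hb⟩ := exists_profile_eq_coe hT (profile_ne_top_of_le hT hle)
  have h3 := profile_le hT hle
  rw [hb, EReal.coe_le_coe_iff] at h3
  rw [index_of_coe hr hb, index_of_coe hr hs, EReal.coe_le_coe_iff]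
  calc k' * (b - r) ≤ k' * (k / k' * (s - r)) := mul_le_mul_of_nonneg_left (by linarith) hk'.le
    _ = k * (s - r) := by field_simp

/-- `Ḟ⁻¹(θ)` is a subgradient of the profile at `θ ∈ Θ`. -/
theorem mul_FdotInv_le_index (hT : E.Theta.Nontrivial) {θ n α : ℝ} (hn : 0 < n)
    (hθ : θ ∈ E.Theta) : ((α * E.FdotInv θ : ℝ) : EReal) ≤ E.index θ n α := by
  have hr := profile_of_mem hθ
  by_cases hs : E.profile (θ + α / n) = ⊤
  · rw [index_of_coe_top hn hr hs]; exact le_top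
  obtain ⟨s, hs⟩ := exists_profile_eq_coe hT hs
  have h := le_of_profile_eq hT hs (FdotInv_mem hθ)
  rw [index_of_coe hr hs, EReal.coe_le_coe_iff]
  calc α * E.FdotInv θ = n * (α / n * E.FdotInv θ) := by field_simp
    _ ≤ _ := mul_le_mul_of_nonneg_left (by linarith) hn.le

theorem FdotInv_le_xi_of_lt_Kstar {θ' θ'' k : ℝ} (hk : 0 < k) (h : k < E.Kstar θ' θ'') :
    ((E.FdotInv θ' : ℝ) : EReal) ≤ E.xi k θ'' := by
  by_contra! hlt
  exact h.not_ge (csInf_le ⟨0, fun x hx => hx.1.le⟩ ⟨hk, hlt⟩)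

theorem xi_lt_of_Kstar_lt (hT : E.Theta.Nontrivial) {θ' θ'' k : ℝ} (hθ' : θ' ∈ E.Theta)
    (hθ'' : θ'' ∈ E.Theta) (hlt : θ'' < θ') (h : E.Kstar θ' θ'' < k) :
    E.xi k θ'' < ((E.FdotInv θ' : ℝ) : EReal) := by
  have hne : {k : ℝ | 0 < k ∧ E.xi k θ'' < ((E.FdotInv θ' : ℝ) : EReal)}.Nonempty := by
    -- The choice k = 1/(y - θ'') makes θ'' + 1/k = y, and the slope of g from θ'' to y is at most
    -- Ḟ⁻¹(y) < Ḟ⁻¹(θ').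
    set y := (θ'' + θ') / 2 with hy
    have h1 : θ'' < y := by linarith
    have h2 : y < θ' := by linarith
    have hyT : y ∈ E.Theta := ordConnected_Theta.out hθ'' hθ' ⟨h1.le, h2.le⟩
    have hpos : 0 < y - θ'' := sub_pos.2 h1
    have hs : E.profile (θ'' + 1 / (1 / (y - θ''))) =
        ((y * E.FdotInv y - E.F (E.FdotInv y) : ℝ) : EReal) := by
      rw [one_div_one_div, add_sub_cancel, profile_of_mem hyT]
    refine ⟨1 / (y - θ''), by positivity, ?_⟩
    have hr := profile_of_mem hθ''
    have h3 := le_of_profile_eq hT hr (FdotInv_mem hyT)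
    unfold xi
    rw [index_of_coe hr hs, EReal.coe_lt_coe_iff, one_div_mul_eq_div,
      div_lt_iff₀ hpos]
    have h4 := mul_lt_mul_of_pos_right (strictMonoOn_FdotInv hT hyT hθ' h2) hpos
    nlinarith
  obtain ⟨k', ⟨hk', hlt'⟩, hkk⟩ := exists_lt_of_csInf_lt hne h
  exact (xi_anti hT hk' hkk.le).trans_lt hlt'

/-- An infinite conjugate at x supplies tilts whose density ratio is at least e^c on [x, ∞) for
every c, while their total mass stays one. -/
theorem law_Ici_eq_zero (hT : E.Theta.Nontrivial) {η x : ℝ} (hη : η ∈ E.N) (hx : E.Fdot η ≤ x)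
    (htop : E.profile x = ⊤) : E.law η (Set.Ici x) = 0 := by
  have hN : E.N.Nontrivial := Set.nontrivial_of_image _ _ hT
  have := isProbabilityMeasure_law hη
  have key : ∀ c : ℝ, ENNReal.ofReal (Real.exp c) * E.law η (Set.Ici x) ≤ 1 := by
    intro c
    -- The maximum with 0 forces η ≤ η', so the ratio is increasing and its bound at x holds on the
    -- whole ray.
    have h1 : ((x * η - E.F η + max c 0 : ℝ) : EReal) < ⨆ η ∈ E.N, ((x * η - E.F η : ℝ) : EReal) := by
      rw [← profile_eq_iSup hT, htop]; exact EReal.coe_lt_top _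
    simp only [lt_iSup_iff, EReal.coe_lt_coe_iff] at h1
    obtain ⟨η', hη', hlt⟩ := h1
    have hc : c ≤ max c 0 := le_max_left _ _
    have h0 : (0 : ℝ) ≤ max c 0 := le_max_right _ _
    have hKL := KL_nonneg hN hη hη'
    unfold KL at hKL
    have hle : η ≤ η' := by
      by_contra! hlt'
      nlinarith [mul_nonneg (sub_nonneg.2 hx) (sub_nonneg.2 hlt'.le)]
    rw [← lintegral_exp_sub_mul (η := η) hη']
    refine le_trans ?_ (mul_meas_ge_le_lintegral (by fun_prop) (ENNReal.ofReal (Real.exp c)))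
    gcongr
    intro y hy
    refine ENNReal.ofReal_le_ofReal (Real.exp_le_exp.2 ?_)
    nlinarith [mul_nonneg (sub_nonneg.2 hle) (sub_nonneg.2 (Set.mem_Ici.1 hy))]
  by_contra hne
  have hpos : 0 < (E.law η).real (Set.Ici x) := ENNReal.toReal_pos hne (measure_ne_top _ _)
  -- For c = 2/m, with m the mass of the ray, e^c m ≥ (1 + c) m > 1.
  have h := ENNReal.toReal_mono ENNReal.one_ne_top (key (2 / (E.law η).real (Set.Ici x)))
  rw [ENNReal.toReal_mul, ENNReal.toReal_ofReal (Real.exp_pos _).le, ENNReal.toReal_one] at h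
  change _ * (E.law η).real (Set.Ici x) ≤ 1 at h
  have h2 := Real.add_one_le_exp (2 / (E.law η).real (Set.Ici x))
  have h3 : 2 / (E.law η).real (Set.Ici x) * (E.law η).real (Set.Ici x) = 2 := by field_simp
  nlinarith

/-- The exceptional set is an upper ray, hence a countable union of null closed rays starting at its
rationals and, if it belongs to the set, its infimum. -/
theorem ae_profile_ne_top (hT : E.Theta.Nontrivial) {η : ℝ} (hη : η ∈ E.N) :
    ∀ᵐ x ∂(E.law η), E.Fdot η ≤ x → E.profile x ≠ ⊤ := by
  set U : Set ℝ := {x | E.Fdot η ≤ x ∧ E.profile x = ⊤} with hU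
  have hup : ∀ x ∈ U, ∀ y, x ≤ y → y ∈ U := by
    rintro x ⟨hx, hxt⟩ y hxy
    refine ⟨hx.trans hxy, ?_⟩
    by_contra hy
    exact (convex_profile_ne_top hT).ordConnected.out
      (profile_ne_top_of_mem (x := E.Fdot η) ⟨η, hη, rfl⟩) hy ⟨hx, hxy⟩ hxt
  set I : Set ℝ := U ∩ ({sInf U} ∪ Set.range ((↑) : ℚ → ℝ)) with hI
  have hcount : I.Countable :=
    ((Set.countable_singleton _).union (Set.countable_range _)).mono Set.inter_subset_right
  have hcover : U ⊆ ⋃ x ∈ I, Set.Ici x := by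
    intro x hx
    simp only [Set.mem_iUnion, Set.mem_Ici]
    rcases (csInf_le ⟨E.Fdot η, fun y hy => hy.1⟩ hx : sInf U ≤ x).eq_or_lt with heq | hlt
    · exact ⟨x, ⟨hx, Or.inl heq.symm⟩, le_rfl⟩
    · obtain ⟨u, hu, hux⟩ := exists_lt_of_csInf_lt ⟨x, hx⟩ hlt
      obtain ⟨q, hq1, hq2⟩ := exists_rat_btwn hux
      exact ⟨q, ⟨hup u hu q hq1.le, Or.inr ⟨q, rfl⟩⟩, hq2.le⟩
  have hnull : E.law η U = 0 := by
    refine measure_mono_null hcover ((measure_biUnion_null_iff hcount).2 fun x hx => ?_)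
    exact law_Ici_eq_zero hT hη hx.1.1 hx.1.2
  rw [ae_iff]
  convert hnull using 2
  ext x
  simp [hU]

end ExpFamily

/-! ### Pull counts, conditional reward laws, regret decomposition and Chernoff bound -/

namespace Bandit

variable {Ω : Type*} {K : ℕ} {arm : ℕ → Ω → Fin K} {X : ℕ → Ω → ℝ}

theorem pulls_succ (a : Fin K) (t : ℕ) (ω : Ω) :
    pulls arm a (t + 1) ω = pulls arm a t ω + if arm t ω = a then 1 else 0 := by
  unfold pulls
  rw [Finset.range_add_one, Finset.filter_insert]
  split_ifs with h
  · rw [Finset.card_insert_of_notMem (by simp)]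
  · rfl

theorem pulls_eq_sum (a : Fin K) (t : ℕ) (ω : Ω) :
    (pulls arm a t ω : ℝ) = ∑ s ∈ Finset.range t, {ω | arm s ω = a}.indicator 1 ω := by
  simp only [pulls, Finset.natCast_card_filter, Set.indicator_apply, Set.mem_ofPred_eq,
    Pi.one_apply]

/-- Pulls of `a` made while `N_a ≤ q` number at most `q + 1`. -/
theorem pulls_le_add_sum (a : Fin K) {q : ℝ} (hq : 0 ≤ q) (T : ℕ) (ω : Ω) :
    (pulls arm a T ω : ℝ) ≤ q + 1 + ∑ t ∈ Finset.range T,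
      {ω | arm t ω = a ∧ q < pulls arm a t ω}.indicator (1 : Ω → ℝ) ω := by
  have h0 : ∀ T : ℕ, 0 ≤ ∑ t ∈ Finset.range T,
      {ω | arm t ω = a ∧ q < pulls arm a t ω}.indicator (1 : Ω → ℝ) ω := fun T =>
    Finset.sum_nonneg fun t _ => Set.indicator_nonneg (fun _ _ => zero_le_one) _
  induction T with
  | zero => simpa [pulls] using by linarith
  | succ T ih =>
    have h := h0 (T + 1)
    rw [pulls_succ, Finset.sum_range_succ] at *
    by_cases ha : arm T ω = a
    -- A pull made at a count of at most q leaves at most q + 1 pulls outright; a later pull is paid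
    -- for by its own indicator.
    · rcases le_or_gt (pulls arm a T ω : ℝ) q with hle | hlt
      · simp only [ha, if_true]; push_cast; linarith
      · simp only [Set.indicator_apply, Set.mem_ofPred_eq, ha, hlt, if_true, and_self,
          Pi.one_apply] at *
        push_cast; linarith
    · simp [ha] at *
      linarith

theorem measurable_arm_history {s t : ℕ} (hst : s ≤ t) : Measurable[history arm X t] (arm s) := by
  rcases hst.eq_or_lt with rfl | hlt
  · exact Measurable.of_comap_le le_sup_right
  · refine Measurable.of_comap_le (le_trans ?_ le_sup_left)
    exact le_trans le_sup_left (le_iSup₂ (f := fun s (_ : s ∈ Finset.range t) =>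
      (MeasurableSpace.comap (arm s) inferInstance ⊔ MeasurableSpace.comap (X s) inferInstance))
      s (Finset.mem_range.2 hlt))

theorem measurable_X_history {s t : ℕ} (hst : s < t) : Measurable[history arm X t] (X s) := by
  refine Measurable.of_comap_le (le_trans ?_ le_sup_left)
  exact le_trans le_sup_right (le_iSup₂ (f := fun s (_ : s ∈ Finset.range t) =>
    (MeasurableSpace.comap (arm s) inferInstance ⊔ MeasurableSpace.comap (X s) inferInstance))
    s (Finset.mem_range.2 hst))

variable [mΩ : MeasurableSpace Ω] {P : Measure Ω} {ν : Fin K → Measure ℝ}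

namespace IsInteraction

theorem history_le (h : IsInteraction P ν arm X) (t : ℕ) : history arm X t ≤ mΩ :=
  sup_le (iSup₂_le fun s _ => sup_le (h.measurable_arm s).comap_le (h.measurable_X s).comap_le)
    (h.measurable_arm t).comap_le

theorem measurableSet_arm (h : IsInteraction P ν arm X) (t : ℕ) (i : Fin K) :
    MeasurableSet {ω | arm t ω = i} := h.measurable_arm t (measurableSet_singleton i)

theorem measurable_pulls (h : IsInteraction P ν arm X) (a : Fin K) (t : ℕ) :
    Measurable fun ω => (pulls arm a t ω : ℝ) := by
  simp only [pulls_eq_sum]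
  exact Finset.measurable_sum _ fun s _ => measurable_one.indicator (h.measurableSet_arm s a)

theorem measurable_total (h : IsInteraction P ν arm X) (a : Fin K) (t : ℕ) :
    Measurable (total arm X a t) := by
  unfold total
  simp only [Finset.sum_filter]
  exact Finset.measurable_sum _ fun s _ =>
    (h.measurable_X s).ite (h.measurableSet_arm s a) measurable_const

variable [IsProbabilityMeasure P]

theorem integrable_indicator_arm (h : IsInteraction P ν arm X) (t : ℕ) (i : Fin K) :
    Integrable ({ω | arm t ω = i}.indicator (1 : Ω → ℝ)) P :=
  (integrable_const (1 : ℝ)).indicator (h.measurableSet_arm t i)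

theorem integral_pulls (h : IsInteraction P ν arm X) (a : Fin K) (T : ℕ) :
    ∫ ω, (pulls arm a T ω : ℝ) ∂P = ∑ t ∈ Finset.range T, P.real {ω | arm t ω = a} := by
  simp only [pulls_eq_sum]
  rw [integral_finsetSum _ fun t _ =>
    h.integrable_indicator_arm t a]
  refine Finset.sum_congr rfl fun t _ => ?_
  rw [integral_indicator_one (h.measurableSet_arm t a)]

theorem integral_pulls_le (h : IsInteraction P ν arm X) (a : Fin K) {q : ℝ} (hq : 0 ≤ q) (T : ℕ) :
    ∫ ω, (pulls arm a T ω : ℝ) ∂P ≤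
      q + 1 + ∑ t ∈ Finset.range T, P.real {ω | arm t ω = a ∧ q < pulls arm a t ω} := by
  have hm : ∀ t, MeasurableSet {ω | arm t ω = a ∧ q < pulls arm a t ω} := fun t =>
    (h.measurableSet_arm t a).inter (measurableSet_lt measurable_const (h.measurable_pulls a t))
  have hi : ∀ t ∈ Finset.range T, Integrable
      ({ω | arm t ω = a ∧ q < pulls arm a t ω}.indicator (1 : Ω → ℝ)) P := fun t _ =>
    (integrable_const (1 : ℝ)).indicator (hm t)
  have hp : Integrable (fun ω => (pulls arm a T ω : ℝ)) P := by
    simp only [pulls_eq_sum]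
    exact integrable_finsetSum _ fun t _ => h.integrable_indicator_arm t a
  refine (integral_mono hp ((integrable_const (q + 1)).add (integrable_finsetSum _ hi))
    (pulls_le_add_sum a hq T)).trans_eq ?_
  simp only [Pi.add_apply]
  rw [integral_add (integrable_const _) (integrable_finsetSum _ hi), integral_finsetSum _ hi]
  simp [integral_indicator_one (hm _)]

variable [∀ i, IsProbabilityMeasure (ν i)]

/-- The reward of a round, restricted to an event of the past on which arm `i` is pulled. -/
theorem map_restrict (h : IsInteraction P ν arm X) {t : ℕ} {i : Fin K} {A : Set Ω}
    (hA : MeasurableSet[history arm X t] A) (hAi : A ⊆ {ω | arm t ω = i}) :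
    (P.restrict A).map (X t) = P A • ν i := by
  have hm := h.history_le t
  ext B hB
  have hX := h.measurable_X t hB
  rw [Measure.map_apply (h.measurable_X t) hB, Measure.restrict_apply hX, Measure.smul_apply,
    smul_eq_mul]
  have h1 : ∫ ω in A, (P⟦X t ⁻¹' B | history arm X t⟧) ω ∂P = P.real (X t ⁻¹' B ∩ A) := by
    rw [setIntegral_condExp hm ((integrable_const (1 : ℝ)).indicator hX) hA,
      integral_indicator hX, Measure.restrict_restrict hX]
    simp
  have h2 : ∫ ω in A, (P⟦X t ⁻¹' B | history arm X t⟧) ω ∂P = P.real A * (ν i).real B := by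
    rw [setIntegral_congr_ae (g := fun _ => (ν i).real B) (hm A hA)]
    · simp
    · filter_upwards [h.cond_law t B hB] with ω hω hωA
      rw [hω]
      have : arm t ω = i := hAi hωA
      simp only [this]
  rw [h1] at h2
  rw [← ofReal_measureReal, h2, ENNReal.ofReal_mul measureReal_nonneg, ofReal_measureReal,
    ofReal_measureReal]

theorem map_restrict_arm (h : IsInteraction P ν arm X) (t : ℕ) (i : Fin K) :
    (P.restrict {ω | arm t ω = i}).map (X t) = P {ω | arm t ω = i} • ν i :=
  h.map_restrict (measurable_arm_history le_rfl (measurableSet_singleton i)) subset_rfl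

/-- On the event that arm i is pulled, the reward is independent of the past: the restriction of P
weighted by f(X_t) is, on the history σ-algebra, a constant multiple of the restriction of P. -/
theorem setLIntegral_mul (h : IsInteraction P ν arm X) (t : ℕ) (i : Fin K) {G : Ω → ℝ≥0∞}
    (hG : Measurable[history arm X t] G) {f : ℝ → ℝ≥0∞} (hf : Measurable f) :
    ∫⁻ ω in {ω | arm t ω = i}, G ω * f (X t ω) ∂P =
      (∫⁻ ω in {ω | arm t ω = i}, G ω ∂P) * ∫⁻ x, f x ∂(ν i) := by
  have hm := h.history_le t
  have hfX : Measurable fun ω => f (X t ω) := hf.comp (h.measurable_X t)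
  have hi : MeasurableSet[history arm X t] {ω | arm t ω = i} :=
    measurable_arm_history le_rfl (measurableSet_singleton i)
  have key : ((P.restrict {ω | arm t ω = i}).withDensity fun ω => f (X t ω)).trim hm =
      (∫⁻ x, f x ∂(ν i)) • (P.restrict {ω | arm t ω = i}).trim hm := by
    refine @Measure.ext _ (history arm X t) _ _ fun S hS => ?_
    rw [trim_measurableSet_eq hm hS, withDensity_apply _ (hm S hS), Measure.smul_apply,
      trim_measurableSet_eq hm hS, Measure.restrict_restrict (hm S hS),
      Measure.restrict_apply (hm S hS), ← lintegral_map hf (h.measurable_X t),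
      h.map_restrict (hS.inter hi) Set.inter_subset_right, lintegral_smul_measure, smul_eq_mul,
      smul_eq_mul, mul_comm]
  have h1 := lintegral_trim (μ := (P.restrict {ω | arm t ω = i}).withDensity
    fun ω => f (X t ω)) hm hG
  rw [key, lintegral_smul_measure, lintegral_trim hm hG,
    lintegral_withDensity_eq_lintegral_mul _ hfX (hG.mono hm le_rfl)] at h1
  rw [mul_comm, ← smul_eq_mul, h1]
  simp only [Pi.mul_apply, mul_comm]

/-- A likelihood ratio of the observations of one arm has expectation one. -/
theorem lintegral_prod_eq_one (h : IsInteraction P ν arm X) (a : Fin K) {L : ℝ → ℝ≥0∞}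
    (hL : Measurable L) (hL1 : ∫⁻ x, L x ∂(ν a) = 1) (t : ℕ) :
    ∫⁻ ω, ∏ s ∈ (Finset.range t).filter (fun s => arm s ω = a), L (X s ω) ∂P = 1 := by
  simp only [Finset.prod_filter]
  induction t with
  | zero => simp
  | succ t ih =>
    have ha := h.measurableSet_arm t a
    have hG : Measurable[history arm X t] fun ω =>
        ∏ s ∈ Finset.range t, if arm s ω = a then L (X s ω) else 1 := by
      refine Finset.measurable_prod _ fun s hs => ?_
      have hs := Finset.mem_range.1 hs
      exact Measurable.ite (measurable_arm_history hs.le (measurableSet_singleton a))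
        (hL.comp (measurable_X_history hs)) measurable_const
    simp only [Finset.prod_range_succ]
    refine Eq.trans ?_ ih
    rw [← lintegral_add_compl _ ha,
      ← lintegral_add_compl (fun ω => ∏ s ∈ Finset.range t, if arm s ω = a then L (X s ω) else 1) ha]
    congr 1
    · rw [setLIntegral_congr_fun ha (g := fun ω => (∏ s ∈ Finset.range t,
        if arm s ω = a then L (X s ω) else 1) * L (X t ω))
        (fun ω (hω : arm t ω = a) => by simp only [hω, if_true])]
      rw [h.setLIntegral_mul t a hG hL, hL1, mul_one]
    · exact setLIntegral_congr_fun ha.compl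
        (fun ω (hω : ¬ arm t ω = a) => by simp only [hω, if_false, mul_one])

theorem ae_reward (h : IsInteraction P ν arm X) (t : ℕ) (i : Fin K) {p : ℝ → Prop}
    (hp : ∀ᵐ x ∂(ν i), p x) : ∀ᵐ ω ∂P, arm t ω = i → p (X t ω) := by
  have hi := h.measurableSet_arm t i
  refine (ae_restrict_iff' hi).1 ?_
  refine ae_of_ae_map (h.measurable_X t).aemeasurable ?_
  rw [h.map_restrict_arm t i]
  exact Measure.ae_smul_measure hp _

theorem map_reward (h : IsInteraction P ν arm X) (t : ℕ) :
    P.map (X t) = ∑ i, P {ω | arm t ω = i} • ν i := by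
  ext B hB
  have hX := h.measurable_X t hB
  rw [Measure.map_apply (h.measurable_X t) hB, Measure.finsetSum_apply]
  simp_rw [← h.map_restrict_arm t, Measure.map_apply (h.measurable_X t) hB, Measure.restrict_apply hX]
  rw [← measure_biUnion_finset]
  · congr 1
    ext ω
    simp
  · intro i _ j _ hij
    refine Set.disjoint_left.2 fun ω h1 h2 => hij ?_
    exact h1.2.symm.trans h2.2
  · exact fun i _ => hX.inter (h.measurableSet_arm t i)

theorem integrable_reward (h : IsInteraction P ν arm X) (hν : ∀ i, Integrable (fun x => x) (ν i))
    (t : ℕ) : Integrable (X t) P := by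
  have : Integrable (fun x => x) (P.map (X t)) := by
    rw [h.map_reward, integrable_finsetSum_measure]
    exact fun i _ => (hν i).smul_measure (measure_ne_top _ _)
  exact this.comp_measurable (h.measurable_X t)

theorem integral_reward (h : IsInteraction P ν arm X) (hν : ∀ i, Integrable (fun x => x) (ν i))
    (t : ℕ) : ∫ ω, X t ω ∂P = ∑ i, P.real {ω | arm t ω = i} * ∫ x, x ∂(ν i) := by
  have h1 : ∫ x, x ∂(P.map (X t)) = ∫ ω, X t ω ∂P :=
    integral_map (h.measurable_X t).aemeasurable (by fun_prop)
  rw [← h1, h.map_reward, integral_finsetSum_measure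
    fun i _ => (hν i).smul_measure (measure_ne_top _ _)]
  simp only [integral_smul_measure, smul_eq_mul]
  rfl

/-- Each reward is distributed as a mixture of the arm laws, weighted by the probabilities of
pulling them. -/
theorem regret_eq (h : IsInteraction P ν arm X) (hν : ∀ i, Integrable (fun x => x) (ν i))
    {θ : Fin K → ℝ} (hθ : ∀ i, θ i = ∫ x, x ∂(ν i)) (b : Fin K) (T : ℕ) :
    regret P (θ b) X T =
      ∑ a ∈ Finset.univ.erase b, gap θ b a * ∫ ω, (pulls arm a T ω : ℝ) ∂P := by
  have hsum : ∀ t, ∑ i, P.real {ω | arm t ω = i} = 1 := fun t => by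
    have : (Set.univ : Set Ω) = ⋃ i ∈ Finset.univ, {ω | arm t ω = i} := by ext; simp
    rw [← probReal_univ (μ := P), this, measureReal_biUnion_finset]
    · intro i _ j _ hij
      exact Set.disjoint_left.2 fun ω h1 h2 => hij (h1.symm.trans h2)
    · exact fun i _ => h.measurableSet_arm t i
  have h0 : gap θ b b * ∫ ω, (pulls arm b T ω : ℝ) ∂P = 0 := by simp [gap]
  rw [← zero_add (∑ a ∈ _, _), ← h0,
    Finset.add_sum_erase Finset.univ (fun a => gap θ b a * ∫ ω, (pulls arm a T ω : ℝ) ∂P)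
      (Finset.mem_univ b), regret, integral_finsetSum _ fun t _ => h.integrable_reward hν t]
  simp only [h.integral_reward hν, ← hθ, h.integral_pulls, Finset.mul_sum, gap]
  have hT : (T : ℝ) * θ b = ∑ t ∈ Finset.range T, θ b := by simp
  rw [Finset.sum_comm (s := Finset.univ), hT, ← Finset.sum_sub_distrib]
  refine Finset.sum_congr rfl fun t _ => ?_
  simp only [sub_mul, Finset.sum_sub_distrib, ← Finset.mul_sum, hsum, mul_one, mul_comm]

end IsInteraction

/-- Chernoff bound for the empirical mean of an arm at a fixed time, uniformly over large numbers
of pulls: the empirical mean is beyond the mean of the member `η'`, seen from that of the arm. -/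
theorem measure_deviation_le {E : ExpFamily} [IsProbabilityMeasure P] {η : Fin K → ℝ}
    (hη : ∀ i, η i ∈ E.N) (h : IsInteraction P (fun i => E.law (η i)) arm X)
    (a : Fin K) {η' q : ℝ} (hη' : η' ∈ E.N) (hKL : 0 ≤ E.KL η' (η a)) (t : ℕ) :
    P.real {ω | q ≤ pulls arm a t ω ∧
      (η' - η a) * (E.Fdot η' * pulls arm a t ω) ≤ (η' - η a) * total arm X a t ω} ≤
    Real.exp (-(q * E.KL η' (η a))) := by
  have := fun i => E.isProbabilityMeasure_law (hη i)
  have hone := h.lintegral_prod_eq_one a (L := fun x => ENNReal.ofReal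
    (Real.exp ((η' - η a) * x - (E.F η' - E.F (η a))))) (by fun_prop)
    (ExpFamily.lintegral_exp_sub_mul hη') t
  have hprod : ∀ ω, ∏ s ∈ (Finset.range t).filter (fun s => arm s ω = a), ENNReal.ofReal
      (Real.exp ((η' - η a) * X s ω - (E.F η' - E.F (η a)))) = ENNReal.ofReal (Real.exp
      ((η' - η a) * total arm X a t ω - (E.F η' - E.F (η a)) * pulls arm a t ω)) := fun ω => by
    rw [← ENNReal.ofReal_prod_of_nonneg fun s _ => (Real.exp_pos _).le, ← Real.exp_sum,
      Finset.sum_sub_distrib, ← Finset.mul_sum, Finset.sum_const, nsmul_eq_mul]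
    simp only [total, pulls, mul_comm]
  simp only [hprod] at hone
  have hmeas : Measurable fun ω => ENNReal.ofReal (Real.exp
      ((η' - η a) * total arm X a t ω - (E.F η' - E.F (η a)) * pulls arm a t ω)) :=
    (((h.measurable_total a t).const_mul _).sub
      ((h.measurable_pulls a t).const_mul _)).exp.ennreal_ofReal
  have hM := mul_meas_ge_le_lintegral (μ := P) hmeas
    (ENNReal.ofReal (Real.exp (q * E.KL η' (η a))))
  rw [hone] at hM
  have hsub : {ω | q ≤ pulls arm a t ω ∧
      (η' - η a) * (E.Fdot η' * pulls arm a t ω) ≤ (η' - η a) * total arm X a t ω} ⊆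
      {ω | ENNReal.ofReal (Real.exp (q * E.KL η' (η a))) ≤ ENNReal.ofReal (Real.exp
      ((η' - η a) * total arm X a t ω - (E.F η' - E.F (η a)) * pulls arm a t ω))} := by
    rintro ω ⟨h1, h2⟩
    refine ENNReal.ofReal_le_ofReal (Real.exp_le_exp.2 ?_)
    -- Since KL ≥ 0, the random count can be replaced by its lower bound q, so no union over counts
    -- is needed.
    have h3 := mul_le_mul_of_nonneg_right h1 hKL
    have h4 : (pulls arm a t ω : ℝ) * E.KL η' (η a) =
      (η' - η a) * (E.Fdot η' * pulls arm a t ω) - (E.F η' - E.F (η a)) * pulls arm a t ω := by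
      unfold ExpFamily.KL; ring
    linarith
  have hM2 := ENNReal.toReal_mono ENNReal.one_ne_top hM
  rw [ENNReal.toReal_mul, ENNReal.toReal_ofReal (Real.exp_pos _).le, ENNReal.toReal_one] at hM2
  rw [Real.exp_neg]
  refine (measureReal_mono hsub).trans ?_
  rw [← one_div, le_div_iff₀' (Real.exp_pos _)]
  exact hM2

end Bandit

/-! ### Comparison of the indices of two arms -/

namespace ExpFamily

variable {E : ExpFamily}

/-- An arm `a` pulled often whose empirical mean is not too large has a smaller index than an
arm `b` that was pulled rarely or whose empirical mean is not too small. -/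
theorem index_lt_index (hT : E.Theta.Nontrivial) {θlow θdn θmid θup pa pb na nb α : ℝ}
    (hdn : θdn ∈ E.Theta) (hmid : θmid ∈ E.Theta) (hup : θup ∈ E.Theta) (h1 : θup < θmid)
    (h2 : θmid ≤ θdn) (hα : 0 < α) (hna : 0 < na) (hnb : 0 < nb)
    (hK : α * E.Kstar θmid θup < na) (hpa : pa ≤ θup) (hlow : θlow ≤ pb)
    (hpb : E.profile pb ≠ ⊤) (h : nb < α * E.Kstar θdn θlow ∨ θdn ≤ pb) :
    E.index pa na α < E.index pb nb α := by
  -- The two indices are separated by the level α Ḟ⁻¹(θmid); strictness comes from this side.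
  have hupper : E.index pa na α < ((α * E.FdotInv θmid : ℝ) : EReal) := by
    refine (index_le_index hT hna hα.le hpa (profile_ne_top_of_mem hup)).trans_lt ?_
    rw [index_eq_mul_xi hT hna hα]
    have hxi := xi_lt_of_Kstar_lt hT hmid hup h1 (k := na / α) (by rwa [lt_div_iff₀' hα])
    generalize E.xi (na / α) θup = x at hxi
    induction x with
    | bot => rw [EReal.coe_mul_bot_of_pos hα]; exact EReal.bot_lt_coe _
    | coe x =>
      rw [← EReal.coe_mul, EReal.coe_lt_coe_iff]
      exact mul_lt_mul_of_pos_left (EReal.coe_lt_coe_iff.1 hxi) hα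
    | top => exact absurd hxi not_top_lt
  refine hupper.trans_le ?_
  refine le_trans (EReal.coe_le_coe_iff.2 (mul_le_mul_of_nonneg_left
    ((strictMonoOn_FdotInv hT).monotoneOn hmid hdn h2) hα.le)) ?_
  rcases h with h | h
  · refine le_trans ?_ (index_le_index hT hnb hα.le hlow hpb)
    rw [index_eq_mul_xi hT hnb hα, EReal.coe_mul]
    refine mul_le_mul_of_nonneg_left ?_ (EReal.coe_nonneg.2 hα.le)
    exact FdotInv_le_xi_of_lt_Kstar (div_pos hnb hα) (by rwa [div_lt_iff₀' hα])
  · exact (mul_FdotInv_le_index hT hnb hdn).trans (index_le_index hT hnb hα.le h hpb)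

/-- An infinite conjugate makes ξ equal to -∞ for all k > 0, so every such k would qualify and K*
would be 0. -/
theorem profile_ne_top_of_Kstar_pos {θ' θ'' : ℝ} (h : 0 < E.Kstar θ' θ'') :
    E.profile θ'' ≠ ⊤ := by
  intro htop
  have h1 := FdotInv_le_xi_of_lt_Kstar (half_pos h) (half_lt_self h)
  rw [xi, index_of_top (half_pos h) htop] at h1
  exact (EReal.bot_lt_coe _).not_ge h1

end ExpFamily

/-! ### Expected number of suboptimal pulls -/

namespace Bandit

variable {Ω : Type*} {K : ℕ} {arm : ℕ → Ω → Fin K} {X : ℕ → Ω → ℝ}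

theorem empMean_mem {S : Set ℝ} (hS : Convex ℝ S) {a : Fin K} {t : ℕ} {ω : Ω}
    (h : ∀ s, arm s ω = a → X s ω ∈ S) (hp : pulls arm a t ω ≠ 0) : empMean arm X a t ω ∈ S := by
  have hp' : (pulls arm a t ω : ℝ) ≠ 0 := Nat.cast_ne_zero.2 hp
  have := hS.sum_mem (t := (Finset.range t).filter fun s => arm s ω = a)
    (w := fun _ => (pulls arm a t ω : ℝ)⁻¹) (z := fun s => X s ω)
    (fun _ _ => by positivity)
    (by rw [Finset.sum_const, nsmul_eq_mul]; exact mul_inv_cancel₀ hp')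
    (fun s hs => h s (Finset.mem_filter.1 hs).2)
  simp only [smul_eq_mul, ← Finset.mul_sum] at this
  rwa [empMean, div_eq_inv_mul]

theorem two_le_of_pulls_ne_zero {a b : Fin K} (hab : a ≠ b) {t : ℕ} {ω : Ω}
    (ha : pulls arm a t ω ≠ 0) (hb : pulls arm b t ω ≠ 0) : 2 ≤ t := by
  match t with
  | 0 => exact absurd (by simp [pulls]) ha
  | 1 =>
    rw [pulls_succ] at ha hb
    simp only [pulls, Finset.range_zero, Finset.filter_empty, Finset.card_empty, zero_add, ne_eq,
      ite_eq_right_iff, one_ne_zero, imp_false, not_not] at ha hb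
    exact absurd (ha.symm.trans hb) hab
  | t + 2 => omega

variable [MeasurableSpace Ω] {P : Measure Ω} [IsProbabilityMeasure P] {E : ExpFamily} {η : Fin K → ℝ}

/-- Almost every reward lies in the convex set where both properties hold, and the empirical mean is
a convex combination of rewards. -/
theorem ae_empMean (hT : E.Theta.Nontrivial) (hη : ∀ i, η i ∈ E.N)
    (h : IsInteraction P (fun i => E.law (η i)) arm X) (b : Fin K) {θlow : ℝ}
    (hlow : ∀ᵐ x ∂(E.law (η b)), θlow ≤ x) (hfin : E.profile θlow ≠ ⊤) :
    ∀ᵐ ω ∂P, ∀ t, pulls arm b t ω ≠ 0 →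
      θlow ≤ empMean arm X b t ω ∧ E.profile (empMean arm X b t ω) ≠ ⊤ := by
  have := fun i => E.isProbabilityMeasure_law (hη i)
  have hS : ∀ᵐ x ∂(E.law (η b)), x ∈ Set.Ici θlow ∩ {x | E.profile x ≠ ⊤} := by
    filter_upwards [hlow, ExpFamily.ae_profile_ne_top hT (hη b)] with x h1 h2
    refine ⟨h1, ?_⟩
    rcases le_total (E.Fdot (η b)) x with hle | hle
    · exact h2 hle
    · exact (ExpFamily.convex_profile_ne_top hT).ordConnected.out hfin
        (ExpFamily.profile_ne_top_of_mem ⟨η b, hη b, rfl⟩) ⟨h1, hle⟩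
  filter_upwards [ae_all_iff.2 fun s => h.ae_reward s b hS] with ω hω t ht
  exact empMean_mem ((convex_Ici θlow).inter (ExpFamily.convex_profile_ne_top hT)) hω ht

theorem exp_neg_four_mul_log_le {D : ℝ} (hD : 0 < D) {t : ℕ} (ht : 1 ≤ t) :
    Real.exp (-(4 / D * Real.log t * D)) ≤ 1 / (t : ℝ) ^ 2 := by
  have ht' : (1 : ℝ) ≤ t := by exact_mod_cast ht
  have hpos : (0 : ℝ) < t := by linarith
  have hlog := Real.log_nonneg ht'
  have e : 1 / (t : ℝ) ^ 2 = Real.exp (-(2 * Real.log t)) := by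
    rw [Real.exp_neg, two_mul, Real.exp_add, Real.exp_log hpos, one_div, sq]
  rw [e, show 4 / D * Real.log t * D = 4 * Real.log t by field_simp]
  exact Real.exp_le_exp.2 (by linarith)

theorem measure_total_ge_le (hT : E.Theta.Nontrivial) (hη : ∀ i, η i ∈ E.N)
    (h : IsInteraction P (fun i => E.law (η i)) arm X) (a : Fin K) {θ' : ℝ} (hθ' : θ' ∈ E.Theta)
    (hlt : E.Fdot (η a) < θ') {t : ℕ} (ht : 1 ≤ t) :
    P.real {ω | 4 / E.D θ' (E.Fdot (η a)) * Real.log t ≤ pulls arm a t ω ∧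
      θ' * pulls arm a t ω ≤ total arm X a t ω} ≤ 1 / (t : ℝ) ^ 2 := by
  have hmem : E.Fdot (η a) ∈ E.Theta := ⟨η a, hη a, rfl⟩
  have hD := ExpFamily.D_pos hT hθ' hmem hlt.ne'
  have hle : 0 ≤ E.FdotInv θ' - η a := by
    rw [sub_nonneg, ← ExpFamily.FdotInv_Fdot hT (hη a)]
    exact ((ExpFamily.strictMonoOn_FdotInv hT) hmem hθ' hlt).le
  refine le_trans ?_ (exp_neg_four_mul_log_le hD ht)
  have hDeq : E.D θ' (E.Fdot (η a)) = E.KL (E.FdotInv θ') (η a) := by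
    rw [ExpFamily.D, ExpFamily.FdotInv_Fdot hT (hη a)]
  rw [hDeq] at hD ⊢
  refine le_trans (measureReal_mono ?_) (measure_deviation_le hη h a (ExpFamily.FdotInv_mem hθ')
    hD.le t)
  rintro ω ⟨h1, h2⟩
  refine ⟨h1, ?_⟩
  rw [ExpFamily.Fdot_FdotInv hθ']
  exact mul_le_mul_of_nonneg_left h2 hle

theorem measure_total_le_le (hT : E.Theta.Nontrivial) (hη : ∀ i, η i ∈ E.N)
    (h : IsInteraction P (fun i => E.law (η i)) arm X) (a : Fin K) {θ' : ℝ} (hθ' : θ' ∈ E.Theta)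
    (hlt : θ' < E.Fdot (η a)) {t : ℕ} (ht : 1 ≤ t) :
    P.real {ω | 4 / E.D θ' (E.Fdot (η a)) * Real.log t ≤ pulls arm a t ω ∧
      total arm X a t ω ≤ θ' * pulls arm a t ω} ≤ 1 / (t : ℝ) ^ 2 := by
  have hmem : E.Fdot (η a) ∈ E.Theta := ⟨η a, hη a, rfl⟩
  have hD := ExpFamily.D_pos hT hθ' hmem hlt.ne
  have hle : E.FdotInv θ' - η a ≤ 0 := by
    rw [sub_nonpos, ← ExpFamily.FdotInv_Fdot hT (hη a)]
    exact ((ExpFamily.strictMonoOn_FdotInv hT) hθ' hmem hlt).le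
  refine le_trans ?_ (exp_neg_four_mul_log_le hD ht)
  have hDeq : E.D θ' (E.Fdot (η a)) = E.KL (E.FdotInv θ') (η a) := by
    rw [ExpFamily.D, ExpFamily.FdotInv_Fdot hT (hη a)]
  rw [hDeq] at hD ⊢
  refine le_trans (measureReal_mono ?_) (measure_deviation_le hη h a (ExpFamily.FdotInv_mem hθ')
    hD.le t)
  rintro ω ⟨h1, h2⟩
  refine ⟨h1, ?_⟩
  rw [ExpFamily.Fdot_FdotInv hθ']
  exact mul_le_mul_of_nonpos_left h2 hle

/-- The expected number of pulls of the suboptimal arm `a`, with thresholds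
`θ_a < θup < θmid ≤ θdn < θ_b`. -/
theorem integral_pulls_le_of_thresholds (hT : E.Theta.Nontrivial) (hη : ∀ i, η i ∈ E.N)
    (h : IsInteraction P (fun i => E.law (η i)) arm X) {a b : Fin K} (hab : a ≠ b)
    {θlow θup θmid θdn C : ℝ} (hlow : ∀ᵐ x ∂(E.law (η b)), θlow ≤ x)
    (hup : θup ∈ E.Theta) (hmid : θmid ∈ E.Theta) (hdn : θdn ∈ E.Theta)
    (h1 : E.Fdot (η a) < θup) (h2 : θup < θmid) (h3 : θmid ≤ θdn) (h4 : θdn < E.Fdot (η b))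
    (hKstar : 0 < E.Kstar θdn θlow)
    (hC : 4 / (E.D θdn (E.Fdot (η b)) * E.Kstar θdn θlow) ≤ C)
    (hpol : ∀ᵐ ω ∂P, FollowsRBMLE E (fun t => C * Real.log t) arm X ω) (T : ℕ) :
    ∫ ω, (pulls arm a T ω : ℝ) ∂P ≤
      max (4 / E.D θup (E.Fdot (η a))) (C * E.Kstar θmid θup) * Real.log T + 1 + Real.pi ^ 2 / 3 := by
  have := fun i => E.isProbabilityMeasure_law (hη i)
  have hDa := ExpFamily.D_pos hT hup ⟨η a, hη a, rfl⟩ h1.ne'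
  have hDb := ExpFamily.D_pos hT hdn ⟨η b, hη b, rfl⟩ h4.ne
  set c := max (4 / E.D θup (E.Fdot (η a))) (C * E.Kstar θmid θup) with hc
  have hc1 : 4 / E.D θup (E.Fdot (η a)) ≤ c := le_max_left _ _
  have hc2 : C * E.Kstar θmid θup ≤ c := le_max_right _ _
  have hc0 : 0 ≤ c := le_trans (by positivity) hc1
  have hC0 : 0 < C := lt_of_lt_of_le (by positivity) hC
  have hC' : 4 / E.D θdn (E.Fdot (η b)) ≤ C * E.Kstar θdn θlow := by
    rw [div_le_iff₀ (mul_pos hDb hKstar)] at hC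
    rw [div_le_iff₀ hDb]
    linarith
  have hlogT := Real.log_natCast_nonneg T
  have hstep : ∀ t ∈ Finset.range T,
      P.real {ω | arm t ω = a ∧ c * Real.log T < pulls arm a t ω} ≤ 2 * (1 / (t : ℝ) ^ 2) := by
    intro t ht
    have htT := Finset.mem_range.1 ht
    have hae : ∀ᵐ ω ∂P, (arm t ω = a ∧ c * Real.log T < pulls arm a t ω) → 2 ≤ t ∧
        ((4 / E.D θup (E.Fdot (η a)) * Real.log t ≤ pulls arm a t ω ∧
          θup * pulls arm a t ω ≤ total arm X a t ω) ∨
        (4 / E.D θdn (E.Fdot (η b)) * Real.log t ≤ pulls arm b t ω ∧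
          total arm X b t ω ≤ θdn * pulls arm b t ω)) := by
      filter_upwards [hpol, ae_empMean hT hη h b hlow
        (ExpFamily.profile_ne_top_of_Kstar_pos hKstar)] with ω hω hmean
      -- A positive count for the pulled arm rules out the initial phase, so the index rule applies.
      rintro ⟨harm, hlt⟩
      have hNa : (0 : ℝ) < pulls arm a t ω := lt_of_le_of_lt (by positivity) hlt
      have hne : ∀ i, pulls arm i t ω ≠ 0 := fun i hi => by
        have h0 := (hω t).1 ⟨i, hi⟩
        rw [harm] at h0
        simp [h0] at hNa
      have hNb : (0 : ℝ) < pulls arm b t ω := Nat.cast_pos.2 (Nat.pos_of_ne_zero (hne b))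
      have ht2 := two_le_of_pulls_ne_zero hab (hne a) (hne b)
      refine ⟨ht2, ?_⟩
      have ht1 : (1 : ℝ) < t := by exact_mod_cast ht2
      have hlog : 0 < Real.log t := Real.log_pos ht1
      have hlogle : Real.log t ≤ Real.log T :=
        Real.log_le_log (by linarith) (by exact_mod_cast htT.le)
      have hcN : c * Real.log t < pulls arm a t ω :=
        (mul_le_mul_of_nonneg_left hlogle hc0).trans_lt hlt
      -- Without a deviation the index of b would strictly exceed that of the pulled arm a.
      by_contra! hgood
      obtain ⟨hga, hgb⟩ := hgood
      have hga := hga ((mul_le_mul_of_nonneg_right hc1 hlog.le).trans hcN.le)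
      refine (((hω t).2 hne b).trans_eq (by rw [harm])).not_gt ?_
      refine ExpFamily.index_lt_index hT hdn hmid hup h2 h3 (mul_pos hC0 hlog) hNa hNb ?_
        ((div_lt_iff₀ hNa).2 hga).le (hmean t (hne b)).1 (hmean t (hne b)).2 ?_
      · rw [mul_right_comm]
        exact (mul_le_mul_of_nonneg_right hc2 hlog.le).trans_lt hcN
      -- If b has at least C log t · K* pulls, then it has at least 4 log t / D by the choice of C,
      -- and the absence of a deviation puts its empirical mean above θdn.
      · by_contra! hcon
        refine (hgb (le_trans ?_ hcon.1)).not_ge ((div_lt_iff₀ hNb).1 hcon.2).le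
        rw [mul_right_comm]
        exact mul_le_mul_of_nonneg_right hC' hlog.le
    by_cases ht2 : 2 ≤ t
    · refine (ENNReal.toReal_mono (measure_ne_top P _)
        (measure_mono_ae (hae.mono fun ω h hω => (h hω).2))).trans
        ((measureReal_union_le _ _).trans ?_)
      rw [two_mul]
      exact add_le_add (measure_total_ge_le hT hη h a hup h1 (by omega))
        (measure_total_le_le hT hη h b hdn h4 (by omega))
    -- The event needs two arms already pulled. Its nullity matters at t = 0, where the bound 2 ·
    -- (1/0²) is 0 by convention.
    · have h0 : P {ω | arm t ω = a ∧ c * Real.log T < pulls arm a t ω} = 0 :=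
        measure_eq_zero_iff_ae_notMem.2 (hae.mono fun ω h hω => ht2 (h hω).1)
      rw [measureReal_def, h0, ENNReal.toReal_zero]
      positivity
  refine (h.integral_pulls_le a (mul_nonneg hc0 hlogT) T).trans (add_le_add_right ?_ _)
  refine (Finset.sum_le_sum hstep).trans ?_
  rw [← Finset.mul_sum]
  -- Twice ∑ 1/t² = π²/6 is the constant π²/3.
  have := sum_le_hasSum (Finset.range T) (fun t _ => by positivity) hasSum_zeta_two
  linarith

end Bandit

/-! ### Choice of thresholds and the regret bound -/

theorem mainTheorem1 {Ω : Type*} [MeasurableSpace Ω] (P : Measure Ω) [IsProbabilityMeasure P]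
    (E : ExpFamily) {K : ℕ} (hK : 2 ≤ K)
    -- canonical parameters and means of the arms, and the unique optimal arm
    (η : Fin K → ℝ) (hη : ∀ i, η i ∈ E.N)
    (θ : Fin K → ℝ) (hθ : ∀ i, θ i = E.mean (η i))
    (b : Fin K) (hb : ∀ a, a ≠ b → θ a < θ b)
    -- the lower bound of the rewards
    (θlow : ℝ) (hlow : ∀ η ∈ E.N, ∀ᵐ x ∂(E.law η), θlow ≤ x)
    -- the constant of the bias term
    (ε : ℝ) (hε₀ : 0 < ε) (hε₁ : ε < 1)
    (hKstar : 0 < E.Kstar (θ b - ε / 2 * Bandit.minGap θ b) θlow)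
    (C : ℝ)
    (hC : 4 / (E.D (θ b - ε / 2 * Bandit.minGap θ b) (θ b) *
      E.Kstar (θ b - ε / 2 * Bandit.minGap θ b) θlow) ≤ C)
    -- the interaction of the policy with the bandit
    (arm : ℕ → Ω → Fin K) (X : ℕ → Ω → ℝ)
    (hint : Bandit.IsInteraction P (fun i => E.law (η i)) arm X)
    (hpol : ∀ᵐ ω ∂P, Bandit.FollowsRBMLE E (fun t => C * Real.log t) arm X ω) :
    (∀ a, a ≠ b → ∀ T : ℕ,
      ∫ ω, (Bandit.pulls arm a T ω : ℝ) ∂P ≤ Bandit.Q E θ b ε C a T + Real.pi ^ 2 / 3) ∧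
    (∀ T : ℕ, Integrable (fun ω => ∑ t ∈ Finset.range T, X t ω) P ∧
      Bandit.regret P (θ b) X T ≤
        ∑ a ∈ Finset.univ.erase b, Bandit.gap θ b a *
          (max (4 / E.D (θ a + ε / 2 * Bandit.gap θ b a) (θ a))
            (C * E.Kstar (θ b - ε / 2 * Bandit.gap θ b a) (θ a + ε / 2 * Bandit.gap θ b a)) *
              Real.log T + 1 + Real.pi ^ 2 / 3)) ∧
    (fun T : ℕ => Bandit.regret P (θ b) X T) =O[atTop] (fun T : ℕ => Real.log T) := by
  have hprob := fun i => E.isProbabilityMeasure_law (hη i)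
  have : Nontrivial (Fin K) := Fin.nontrivial_iff_two_le.2 hK
  obtain ⟨a₀, ha₀⟩ := exists_ne b
  have hN : E.N.Nontrivial := ⟨η a₀, hη a₀, η b, hη b, fun he =>
    (hb a₀ ha₀).ne (by rw [hθ, hθ, he])⟩
  have hθF : ∀ i, θ i = E.Fdot (η i) := fun i => (hθ i).trans (ExpFamily.mean_eq_Fdot hN (hη i))
  have hmem : ∀ i, θ i ∈ E.Theta := fun i => ⟨η i, hη i, (hθF i).symm⟩
  have hT : E.Theta.Nontrivial := ⟨θ a₀, hmem a₀, θ b, hmem b, (hb a₀ ha₀).ne⟩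
  have hgap : ∀ a, a ≠ b → 0 < Bandit.gap θ b a := fun a ha => sub_pos.2 (hb a ha)
  have hbetween : ∀ a, a ≠ b → ∀ x, θ a ≤ x → x ≤ θ b → x ∈ E.Theta := fun a _ x h1 h2 =>
    ExpFamily.ordConnected_Theta.out (hmem a) (hmem b) ⟨h1, h2⟩
  have hpulls : ∀ a, a ≠ b → ∀ T : ℕ,
      ∫ ω, (Bandit.pulls arm a T ω : ℝ) ∂P ≤ Bandit.Q E θ b ε C a T + Real.pi ^ 2 / 3 := by
    intro a ha T
    have : Nonempty {a : Fin K // a ≠ b} := ⟨⟨a, ha⟩⟩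
    have hmin : Bandit.minGap θ b ≤ Bandit.gap θ b a :=
      ciInf_le (f := fun a : {a : Fin K // a ≠ b} => Bandit.gap θ b a)
        (Set.finite_range _).bddBelow ⟨a, ha⟩
    have hmin0 : 0 < Bandit.minGap θ b := by
      obtain ⟨a', ha'⟩ := exists_eq_ciInf_of_finite
        (f := fun a : {a : Fin K // a ≠ b} => Bandit.gap θ b a)
      exact (hgap a' a'.2).trans_eq ha'
    have hg := hgap a ha
    have hgdef : Bandit.gap θ b a = θ b - θ a := rfl
    have e1 : 0 < ε / 2 * Bandit.gap θ b a := by positivity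
    have e2 : 0 < ε / 2 * Bandit.minGap θ b := by positivity
    have e3 : ε / 2 * Bandit.minGap θ b ≤ ε / 2 * Bandit.gap θ b a := by gcongr
    -- As ε < 1, each margin is under half the gap, so θup < θmid. The threshold θdn uses the
    -- minimal gap because one constant C must serve all arms.
    have e4 : ε / 2 * Bandit.gap θ b a < 1 / 2 * Bandit.gap θ b a := by gcongr
    have := Bandit.integral_pulls_le_of_thresholds hT hη hint ha
      (θup := θ a + ε / 2 * Bandit.gap θ b a) (θmid := θ b - ε / 2 * Bandit.gap θ b a)
      (hlow _ (hη b))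
      (hbetween a ha _ (by linarith) (by linarith)) (hbetween a ha _ (by linarith) (by linarith))
      (hbetween a ha _ (by linarith) (by linarith)) (by rw [← hθF]; linarith) (by linarith)
      (by linarith) (by rw [← hθF]; linarith) hKstar (by rwa [← hθF]) hpol T
    rwa [← hθF] at this
  have hid := fun i => ExpFamily.integrable_id_law hN (hη i)
  have hreg := hint.regret_eq hid hθ b
  have hregle : ∀ T : ℕ, Bandit.regret P (θ b) X T ≤
      ∑ a ∈ Finset.univ.erase b, Bandit.gap θ b a *
        (Bandit.coeff E θ b ε C a * Real.log T + 1 + Real.pi ^ 2 / 3) := fun T => by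
    rw [hreg]
    exact Finset.sum_le_sum fun a ha => mul_le_mul_of_nonneg_left
      (hpulls a (Finset.ne_of_mem_erase ha) T) (hgap a (Finset.ne_of_mem_erase ha)).le
  refine ⟨hpulls, fun T => ⟨integrable_finsetSum _ fun t _ => hint.integrable_reward hid t,
    hregle T⟩, ?_⟩
  refine IsBigO.of_bound (∑ a ∈ Finset.univ.erase b, Bandit.gap θ b a *
    (Bandit.coeff E θ b ε C a + 1 + Real.pi ^ 2 / 3)) ?_
  -- For T ≥ 3 > e, log T ≥ 1 absorbs the additive constants.
  filter_upwards [eventually_ge_atTop 3] with T hT3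
  have hlog : 1 ≤ Real.log T := by
    rw [Real.le_log_iff_exp_le (by positivity)]
    have : (3 : ℝ) ≤ T := by exact_mod_cast hT3
    linarith [Real.exp_one_lt_d9]
  have hnonneg : 0 ≤ Bandit.regret P (θ b) X T := by
    rw [hreg]
    exact Finset.sum_nonneg fun a ha => mul_nonneg (hgap a (Finset.ne_of_mem_erase ha)).le
      (integral_nonneg fun ω => Nat.cast_nonneg _)
  rw [Real.norm_of_nonneg hnonneg, Real.norm_of_nonneg (zero_le_one.trans hlog), Finset.sum_mul]
  refine (hregle T).trans (Finset.sum_le_sum fun a ha => ?_)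
  rw [mul_assoc]
  refine mul_le_mul_of_nonneg_left ?_ (hgap a (Finset.ne_of_mem_erase ha)).le
  nlinarith [Real.pi_pos, sq_nonneg Real.pi]
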